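/- Consider the (non-restricted, full-duplex, reciprocal) Gaussian Y-channel: users $1,2,3$ and a relay, gains $h_1,h_2,h_3\in\mathbb{R}$ with $h_1^2\ge h_2^2\ge h_3^2$, and power $P\ge 0$. For each ordered pair of distinct users $(j,k)$, user $j$ has a message $m_{jk}$ for user $k$, uniform on a set of $\lceil 2^{nR_{jk}}\rceil$ elements, $R_{jk}\ge0$; the six messages are independent. At times $i=1,\dots,n$ the relay receives $y_{ri}=h_1x_{1i}+h_2x_{2i}+h_3x_{3i}+z_{ri}$ and user $j$ receives $y_{ji}=h_jx_{ri}+z_{ji}$, all noise samples being independent $\mathcal N(0,1)$. User $j$ sends $x_{ji}=f_{ji}(m_{jk},m_{jl},y_j^{i-1})$, the relay sends $x_{ri}=f_{ri}(y_r^{i-1})$, every transmitter satisfies $\frac1n\sum_{i=1}^n\mathbb{E}[X_i^2]\le P$, and user $j$ estimates $(m_{kj},m_{lj})$ (with $\{j,k,l\}=\{1,2,3\}$) from $(y_j^n,m_{jk},m_{jl})$. A tuple $(R_{jk})$ is achievable if there are codes of these rates, one for each length $n$, whose average probability that some user decodes incorrectly tends to $0$ as $n\to\infty$; the sum-capacity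 $C_N$ is the supremum of $\sum_{j\ne k}R_{jk}$ over achievable tuples. A complete decode-and-forward (CDF) scheme is a code of the following form. Each message is split injectively into $B$ submessages, and there are $B+1$ time blocks of equal length, with total length at most $n$. In each of the first $B$ blocks every user sends a codeword that depends only on its own submessages for that block; at the end of the block the relay decodes all six submessages from the signal it received in that block, and in the next block it sends a codeword that depends only on this decoded six-tuple. Nothing else is sent. A sum-rate is achieved by CDF if it is at most the supremum of the sum-rates $\sum_{j\ne k}R_{jk}$ of tuples for which there are CDF schemes, one for each sufficiently large $n$, satisfying the power constraints, such that the average probabilities of error, both at the users and in the decoding at the relay, tend to $0$. Let $C(x)=\frac12\log_2(1+x)$ and $$\underline{C}_{1}=\min\Big\{\tfrac12\big[C(\min\{h_1^2,h_2^2+h_3^2\}P)+C(h_2^2P)+C(h_3^2P)\big],\ C\big((h_1^2+h_2^2+h_3^2)P\big),\ 2C(h_3^2P)\Big\}.$$ Theorem. For all $P\ge0$, $C_N\ge\underline{C}_1$; moreover the sum-rate $\underline{C}_1$ is achieved by CDF. If $h_3\ne0$, this bound gives one degree of freedom: $$\lim_{P\to\infty}\frac{\underline{C}_1}{\frac12\log_2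 P}=1.$$ -/

import Mathlib

open MeasureTheory ProbabilityTheory Filter Topology
open scoped NNReal ENNReal

namespace YChannel

/-- Ordered pairs `(j, k)` of distinct users. The users `1, 2, 3` are the elements `0, 1, 2` of
`Fin 3`; the pair `(j, k)` indexes the message `m_{jk}` sent by user `j` to user `k`. -/
abbrev Pair : Type := {p : Fin 3 × Fin 3 // p.1 ≠ p.2}

/-- Tuples of all six messages, when `m_p` takes `M p` values. -/
abbrev Msgs (M : Pair → ℕ) : Type := (p : Pair) → Fin (M p)

/-- Pairs of messages sent by user `j`. -/
abbrev Sent (M : Pair → ℕ) (j : Fin 3) : Type := (p : {p : Pair // p.1.1 = j}) → Fin (M p.1)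

/-- Pairs of messages intended for user `j`. -/
abbrev Wanted (M : Pair → ℕ) (j : Fin 3) : Type := (p : {p : Pair // p.1.2 = j}) → Fin (M p.1)

/-- The messages of user `j`. -/
def sent {M : Pair → ℕ} (m : Msgs M) (j : Fin 3) : Sent M j := fun p => m p.1

/-- The messages that user `j` wants. -/
def wanted {M : Pair → ℕ} (m : Msgs M) (j : Fin 3) : Wanted M j := fun p => m p.1

/-- A (non-restricted) code with `n` channel uses. The `i`-th symbol of a node may depend on the
symbols received at that node strictly before time `i`. -/
structure Code (M : Pair → ℕ) (n : ℕ) where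
  /-- The encoding functions `f_{ji}` of the users. -/
  userEnc : (j : Fin 3) → (i : Fin n) → Sent M j → (Fin i → ℝ) → ℝ
  /-- The encoding functions `f_{ri}` of the relay. -/
  relayEnc : (i : Fin n) → (Fin i → ℝ) → ℝ
  /-- The decoding functions `g_j` of the users. -/
  dec : (j : Fin 3) → (Fin n → ℝ) → Sent M j → Wanted M j
  measurable_userEnc : ∀ j i w, Measurable (userEnc j i w)
  measurable_relayEnc : ∀ i, Measurable (relayEnc i)
  measurable_dec : ∀ j w, Measurable fun y => dec j y w

/-- Noise realizations over `n` channel uses: at the relay (first component) and at the users. -/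
abbrev Noise (n : ℕ) : Type := (Fin n → ℝ) × (Fin 3 → Fin n → ℝ)

/-- All noise samples are independent and standard normal. -/
noncomputable def noiseLaw (n : ℕ) : Measure (Noise n) :=
  (Measure.pi fun _ => gaussianReal 0 1).prod
    (Measure.pi fun _ => Measure.pi fun _ => gaussianReal 0 1)

section Signals

variable {M : Pair → ℕ} {n : ℕ} (h : Fin 3 → ℝ) (c : Code M n) (m : Msgs M) (z : Noise n)

/-- The first `t` symbols received at the relay and at the users. At each time, the relay receives
`y_r = h₁ x₁ + h₂ x₂ + h₃ x₃ + z_r` and user `j` receives `y_j = h_j x_r + z_j`. -/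
noncomputable def received : (t : ℕ) → t ≤ n → (Fin t → ℝ) × (Fin 3 → Fin t → ℝ)
  | 0, _ => (Fin.elim0, fun _ => Fin.elim0)
  | t + 1, ht =>
    let y := received t (Nat.le_of_succ_le ht)
    (Fin.snoc (α := fun _ => ℝ) y.1
      (∑ j, h j * c.userEnc j ⟨t, ht⟩ (sent m j) (y.2 j) + z.1 ⟨t, ht⟩),
     fun j => Fin.snoc (α := fun _ => ℝ) (y.2 j) (h j * c.relayEnc ⟨t, ht⟩ y.1 + z.2 j ⟨t, ht⟩))

/-- The `i`-th symbol `x_{ji}` sent by user `j`. -/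
noncomputable def userInput (j : Fin 3) (i : Fin n) : ℝ :=
  c.userEnc j i (sent m j) ((received h c m z i i.2.le).2 j)

/-- The `i`-th symbol `x_{ri}` sent by the relay. -/
noncomputable def relayInput (i : Fin n) : ℝ :=
  c.relayEnc i (received h c m z i i.2.le).1

/-- Some user does not recover both messages intended for it. -/
def DecodingError : Prop :=
  ∃ j, c.dec j ((received h c m z n le_rfl).2 j) (sent m j) ≠ wanted m j

end Signals

/-- Expectation over independent uniform messages and the noise. -/
noncomputable def expect {M : Pair → ℕ} {n : ℕ} (X : Msgs M → Noise n → ℝ≥0∞) : ℝ≥0∞ :=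
  (∑ m, ∫⁻ z, X m z ∂noiseLaw n) / (Fintype.card (Msgs M) : ℝ≥0∞)

/-- Probability over independent uniform messages and the noise. -/
noncomputable def prob {M : Pair → ℕ} {n : ℕ} (E : Msgs M → Noise n → Prop) : ℝ≥0∞ :=
  (∑ m, noiseLaw n {z | E m z}) / (Fintype.card (Msgs M) : ℝ≥0∞)

/-- The average power constraint `(1/n) ∑ᵢ E[Xᵢ²] ≤ P` at every user and at the relay. -/
def PowerConstraint {M : Pair → ℕ} {n : ℕ} (h : Fin 3 → ℝ) (P : ℝ) (c : Code M n) : Prop :=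
  (∀ j, (∑ i, expect fun m z => ENNReal.ofReal (userInput h c m z j i ^ 2)) / (n : ℝ≥0∞)
      ≤ ENNReal.ofReal P) ∧
  (∑ i, expect fun m z => ENNReal.ofReal (relayInput h c m z i ^ 2)) / (n : ℝ≥0∞)
      ≤ ENNReal.ofReal P

/-- The number of values of each message at rate `R` (bits per channel use) and length `n`. -/
noncomputable def numMsgs (R : Pair → ℝ≥0) (n : ℕ) (p : Pair) : ℕ :=
  ⌈(2 : ℝ) ^ ((n : ℝ) * (R p : ℝ))⌉₊

/-- There are codes of rate tuple `R`, one for each length, that satisfy the power constraint and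
whose average error probability tends to zero. -/
def Achievable (h : Fin 3 → ℝ) (P : ℝ) (R : Pair → ℝ≥0) : Prop :=
  ∃ c : (n : ℕ) → Code (numMsgs R n) n,
    (∀ n, PowerConstraint h P (c n)) ∧
    Tendsto (fun n => prob (DecodingError h (c n))) atTop (𝓝 0)

/-- The sum-capacity `C_N` of the non-restricted Y-channel. -/
noncomputable def sumCapacity (h : Fin 3 → ℝ) (P : ℝ) : ℝ≥0∞ :=
  ⨆ (R : Pair → ℝ≥0) (_ : Achievable h P R), ∑ p, (R p : ℝ≥0∞)

/-- A complete decode-and-forward scheme. Each message is split into `B` submessages (`K p` possible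
values each) and time into blocks of length `ℓ`. In block `b < B`, each user sends a codeword
chosen by its own `b`-th submessages alone. After block `b` the relay decodes all six `b`-th
submessages from what it received in that block, and in block `b + 1` it sends a codeword chosen by
the decoded six-tuple. Nothing is sent at other times. -/
structure CDFCode (M : Pair → ℕ) (n : ℕ) where
  /-- Block length. -/
  ℓ : ℕ
  /-- Number of message blocks. -/
  B : ℕ
  ℓ_pos : 0 < ℓ
  fits : (B + 1) * ℓ ≤ n
  /-- Number of values of a submessage. -/
  K : Pair → ℕ
  split : (p : Pair) → Fin (M p) → Fin B → Fin (K p)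
  split_injective : ∀ p, Function.Injective (split p)
  /-- Codebooks of the users. -/
  userBook : (j : Fin 3) → Sent K j → Fin ℓ → ℝ
  /-- Decoder of the relay, from one received block. -/
  relayDec : (Fin ℓ → ℝ) → Msgs K
  /-- Codebook of the relay. -/
  relayBook : Msgs K → Fin ℓ → ℝ
  /-- Decoding functions of the users. -/
  dec : (j : Fin 3) → (Fin n → ℝ) → Sent M j → Wanted M j
  measurable_relayDec : Measurable relayDec
  measurable_dec : ∀ j w, Measurable fun y => dec j y w

namespace CDFCode

variable {M : Pair → ℕ} {n : ℕ} (s : CDFCode M n)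

theorem block_lt {ℓ i : ℕ} (hq : 1 ≤ i / ℓ) (k : Fin ℓ) : (i / ℓ - 1) * ℓ + k < i := by
  have h1 : (i / ℓ - 1) * ℓ + ℓ = i / ℓ * ℓ := by
    rw [← Nat.succ_mul, Nat.succ_eq_add_one, Nat.sub_add_cancel hq]
  have h2 := Nat.div_mul_le_self i ℓ
  have h3 := k.2
  omega

theorem index_lt (b : Fin s.B) (k : Fin s.ℓ) : (b : ℕ) * s.ℓ + k < n := by
  have h1 : ((b : ℕ) + 1) * s.ℓ ≤ (s.B + 1) * s.ℓ := Nat.mul_le_mul_right _ (by omega)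
  have h2 : ((b : ℕ) + 1) * s.ℓ = b * s.ℓ + s.ℓ := Nat.succ_mul _ _
  have h3 := s.fits
  have h4 := k.2
  omega

/-- The code for the Y-channel given by the scheme. Time `i` is position `i % ℓ` of block
`i / ℓ`. -/
noncomputable def toCode : Code M n where
  userEnc j i w _ :=
    if hb : (i : ℕ) / s.ℓ < s.B then
      s.userBook j (fun p => s.split p.1 (w p) ⟨i / s.ℓ, hb⟩) ⟨i % s.ℓ, Nat.mod_lt _ s.ℓ_pos⟩
    else 0
  relayEnc i y :=
    if hb : 1 ≤ (i : ℕ) / s.ℓ ∧ (i : ℕ) / s.ℓ ≤ s.B then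
      s.relayBook (s.relayDec fun k => y ⟨(i / s.ℓ - 1) * s.ℓ + k, block_lt hb.1 k⟩)
        ⟨i % s.ℓ, Nat.mod_lt _ s.ℓ_pos⟩
    else 0
  dec := s.dec
  measurable_userEnc _ _ _ := measurable_const
  measurable_relayEnc i := by
    by_cases hb : 1 ≤ (i : ℕ) / s.ℓ ∧ (i : ℕ) / s.ℓ ≤ s.B
    · simp only [dif_pos hb]
      exact (measurable_of_finite fun w => s.relayBook w ⟨i % s.ℓ, Nat.mod_lt _ s.ℓ_pos⟩).comp
        (s.measurable_relayDec.comp (measurable_pi_lambda _ fun k => measurable_pi_apply _))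
    · simp only [dif_neg hb]
      exact measurable_const
  measurable_dec := s.measurable_dec

/-- The relay does not decode all submessages of all blocks correctly. -/
def RelayError (h : Fin 3 → ℝ) (m : Msgs M) (z : Noise n) : Prop :=
  ∃ b : Fin s.B,
    s.relayDec (fun k => (received h s.toCode m z n le_rfl).1 ⟨b * s.ℓ + k, s.index_lt b k⟩)
      ≠ fun p => s.split p (m p) b

end CDFCode

/-- There are complete decode-and-forward schemes of rate tuple `R`, one for each length from some
`N` on, that satisfy the power constraint and for which the average error probabilities of the
users and of the relay tend to zero. -/
def CDFAchievable (h : Fin 3 → ℝ) (P : ℝ) (R : Pair → ℝ≥0) : Prop :=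
  ∃ (N : ℕ) (s : (i : ℕ) → CDFCode (numMsgs R (N + i)) (N + i)),
    (∀ i, PowerConstraint h P (s i).toCode) ∧
    Tendsto (fun i => prob (DecodingError h (s i).toCode)) atTop (𝓝 0) ∧
    Tendsto (fun i => prob ((s i).RelayError h)) atTop (𝓝 0)

/-- The supremum of the sum-rates achieved by complete decode-and-forward. -/
noncomputable def cdfSumRate (h : Fin 3 → ℝ) (P : ℝ) : ℝ≥0∞ :=
  ⨆ (R : Pair → ℝ≥0) (_ : CDFAchievable h P R), ∑ p, (R p : ℝ≥0∞)

/-- `C(x) = ½ log₂ (1 + x)`. -/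
noncomputable def gaussC (x : ℝ) : ℝ := 1 / 2 * Real.logb 2 (1 + x)

/-- The lower bound `C̲₁`. -/
noncomputable def cdfBound (h₁ h₂ h₃ P : ℝ) : ℝ :=
  min (1 / 2 * (gaussC (min (h₁ ^ 2) (h₂ ^ 2 + h₃ ^ 2) * P) + gaussC (h₂ ^ 2 * P)
      + gaussC (h₃ ^ 2 * P)))
    (min (gaussC ((h₁ ^ 2 + h₂ ^ 2 + h₃ ^ 2) * P)) (2 * gaussC (h₃ ^ 2 * P)))

end YChannel

/-!
Within one block the users draw Gaussian codebooks, and a receiver looks for a message that explains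
what it received up to the power of the noise. If a wrong message differs from the right one exactly
at the users in `S`, it leaves the residual `U - V`: here `U` is the noise plus the right codewords
of `S`, and `V`, independent of `U`, comes from the wrong codewords of `S` and has power
`τ = P * ∑ j ∈ S, h j ^ 2`. Since `U` typically has power `1 + τ`, tilting the Gaussian density of
`V` shows that a residual of power `1` has probability about `(1 + τ) ^ (-ℓ / 2)`, so `2 ^ (ℓ * ρ)`
such wrong messages are harmless if `ρ < gaussC τ`.

The relay decodes everything and forwards it with a single Gaussian codebook, for which the same
bound applies with one transmitter; a user knows its own messages, which leaves only those of the
other two users to be resolved. The codebooks that are good on average for the whole sequence of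
submessages of `B` blocks are reused in every block, and the one extra block costs the factor
`(B + 1) / B`, which tends to `1`.

If user `j` splits the rate `r j` evenly between its two messages, the constraints of the uplink and
of the downlink become constraints on the sums of the `r j` over the sets of users, and the three
terms of `cdfBound` are what is needed to choose such `r j` with the required sum.
-/

namespace YChannel

section WeakLaw

theorem tendsto_pi_sum_deviation {Ω : Type*} [MeasurableSpace Ω] (μ : Measure Ω)
    [IsProbabilityMeasure μ] {f : Ω → ℝ} (hf : MemLp f 2 μ) {ε : ℝ} (hε : 0 < ε) :
    Tendsto (fun ℓ : ℕ => (Measure.pi fun _ : Fin ℓ => μ)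
      {x | ε * ℓ < |∑ k, f (x k) - ℓ * μ[f]|}) atTop (𝓝 0) := by
  have memLp_coord (ℓ : ℕ) (k : Fin ℓ) :
      MemLp (fun x : Fin ℓ → Ω => f (x k)) 2 (Measure.pi fun _ => μ) :=
    hf.comp_measurePreserving (measurePreserving_eval (fun _ => μ) k)
  have mean (ℓ : ℕ) : ∫ x, ∑ k, f (x k) ∂Measure.pi (fun _ : Fin ℓ => μ) = ℓ * μ[f] := by
    rw [integral_finsetSum _ fun k _ => (memLp_coord ℓ k).integrable one_le_two]
    simp [integral_comp_eval (μ := fun _ => μ) hf.aestronglyMeasurable]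
  have variance (ℓ : ℕ) :
      Var[fun x => ∑ k, f (x k); Measure.pi fun _ : Fin ℓ => μ] = ℓ * Var[f; μ] := by
    simpa [← Finset.sum_fn] using variance_sum_pi (μ := fun _ : Fin ℓ => μ) fun _ => hf
  have chebyshev (ℓ : ℕ) (hℓ : 0 < ℓ) : (Measure.pi fun _ : Fin ℓ => μ)
      {x | ε * ℓ < |∑ k, f (x k) - ℓ * μ[f]|} ≤ ENNReal.ofReal (Var[f; μ] / ε ^ 2 / ℓ) := by
    have hℓ' : (0 : ℝ) < ℓ := by exact_mod_cast hℓ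
    have hbound := meas_ge_le_variance_div_sq
      (memLp_finsetSum Finset.univ fun k _ => memLp_coord ℓ k) (mul_pos hε hℓ')
    rw [mean, variance] at hbound
    refine (measure_mono (Set.ofPred_subset_ofPred.2 fun x => le_of_lt)).trans
      (hbound.trans_eq (congrArg _ ?_))
    field_simp
  refine tendsto_of_tendsto_of_tendsto_of_le_of_le' tendsto_const_nhds ?_
    (Eventually.of_forall fun _ => zero_le) ((eventually_gt_atTop 0).mono chebyshev)
  simpa using ENNReal.tendsto_ofReal (tendsto_const_div_atTop_nhds_zero_nat (Var[f; μ] / ε ^ 2))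

/-- The probability that the average of `ℓ` squares of independent standard Gaussians is further
than `ε` from its mean. -/
noncomputable def sqDeviation (ε : ℝ) (ℓ : ℕ) : ℝ≥0∞ :=
  (Measure.pi fun _ : Fin ℓ => gaussianReal 0 1) {z | ε * ℓ < |∑ k, z k ^ 2 - ℓ|}

theorem tendsto_sqDeviation {ε : ℝ} (hε : 0 < ε) : Tendsto (sqDeviation ε) atTop (𝓝 0) := by
  have memLp_sq : MemLp (fun z : ℝ => z ^ 2) 2 (gaussianReal 0 1) := by
    have : ENNReal.HolderTriple 4 4 2 := ⟨by
      rw [← ENNReal.toReal_eq_toReal_iff' (by simp) (by simp),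
        ENNReal.toReal_add (by simp) (by simp)]
      norm_num⟩
    simpa [Pi.mul_def, sq] using (memLp_id_gaussianReal' (μ := 0) (v := 1) 4 (by simp)).mul
      (memLp_id_gaussianReal' 4 (by simp))
  have mean_sq : ∫ z, z ^ 2 ∂gaussianReal 0 1 = 1 := by
    simpa [variance_eq_integral aemeasurable_id, integral_id_gaussianReal] using
      variance_id_gaussianReal (μ := 0) (v := 1)
  have hlim := tendsto_pi_sum_deviation _ memLp_sq hε
  simp only [mean_sq, mul_one] at hlim
  exact hlim

theorem pi_sum_sq_deviation {Ω : Type*} [MeasurableSpace Ω] {μ : Measure Ω}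
    [IsProbabilityMeasure μ] {X : Ω → ℝ} {v : ℝ≥0} (hv : v ≠ 0) (hX : Measurable X)
    (law : μ.map X = gaussianReal 0 v) (ε : ℝ) (ℓ : ℕ) :
    (Measure.pi fun _ : Fin ℓ => μ) {x | ε * (ℓ * v) < |∑ k, X (x k) ^ 2 - ℓ * v|}
      = sqDeviation ε ℓ := by
  have hv' : (0 : ℝ) < v := by positivity
  have normalized : MeasurePreserving (fun ω => X ω / √v) μ (gaussianReal 0 1) := by
    refine ⟨by fun_prop, ?_⟩
    rw [← Function.comp_def (· / √(v : ℝ)), ← Measure.map_map (by fun_prop) hX, law,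
      gaussianReal_map_div_const]
    congr 1
    · simp
    · rw [← NNReal.coe_inj]
      simp [hv]
  have hset : MeasurableSet {z : Fin ℓ → ℝ | ε * ℓ < |∑ k, z k ^ 2 - ℓ|} :=
    measurableSet_lt (by fun_prop) (by fun_prop)
  rw [sqDeviation, ← (measurePreserving_pi _ _ fun _ => normalized).measure_preimage
    hset.nullMeasurableSet]
  congr 1 with x
  simp only [Set.mem_ofPred_eq, Set.mem_preimage, div_pow, Real.sq_sqrt hv'.le, ← Finset.sum_div]
  rw [div_sub' hv'.ne', abs_div, abs_of_pos hv', lt_div_iff₀ hv', mul_comm (v : ℝ) ℓ, mul_assoc]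

theorem pi_lt_sum_sq_le {Ω : Type*} [MeasurableSpace Ω] {μ : Measure Ω}
    [IsProbabilityMeasure μ] {X : Ω → ℝ} {v : ℝ≥0} (hv : v ≠ 0) (hX : Measurable X)
    (law : μ.map X = gaussianReal 0 v) (ε : ℝ) (ℓ : ℕ) :
    (Measure.pi fun _ : Fin ℓ => μ) {x | ℓ * (v * (1 + ε)) < ∑ k, X (x k) ^ 2}
      ≤ sqDeviation ε ℓ := by
  rw [← pi_sum_sq_deviation hv hX law ε ℓ]
  refine measure_mono (Set.ofPred_subset_ofPred.2 fun x hx => lt_of_lt_of_le ?_ (le_abs_self _))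
  linarith

theorem pi_sum_sq_lt_le {Ω : Type*} [MeasurableSpace Ω] {μ : Measure Ω}
    [IsProbabilityMeasure μ] {X : Ω → ℝ} {v : ℝ≥0} (hv : v ≠ 0) (hX : Measurable X)
    (law : μ.map X = gaussianReal 0 v) (ε : ℝ) (ℓ : ℕ) :
    (Measure.pi fun _ : Fin ℓ => μ) {x | ∑ k, X (x k) ^ 2 < ℓ * (v * (1 - ε))}
      ≤ sqDeviation ε ℓ := by
  rw [← pi_sum_sq_deviation hv hX law ε ℓ]
  refine measure_mono (Set.ofPred_subset_ofPred.2 fun x hx => lt_of_lt_of_le ?_ (neg_le_abs _))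
  linarith

end WeakLaw

section GaussianTilt

theorem lintegral_exp_sub_sq_gaussianReal {τ : ℝ≥0} (hτ : τ ≠ 0) (u : ℝ) :
    ∫⁻ x, ENNReal.ofReal (Real.exp ((u ^ 2 / (1 + τ) - (u - x) ^ 2) / 2)) ∂gaussianReal 0 τ
      = ENNReal.ofReal (√(1 + τ))⁻¹ := by
  have hone : (0 : ℝ) < 1 + τ := by positivity
  have tilt (x : ℝ) : gaussianPDF 0 τ x *
      ENNReal.ofReal (Real.exp ((u ^ 2 / (1 + τ) - (u - x) ^ 2) / 2))
      = ENNReal.ofReal (√(1 + τ))⁻¹ * gaussianPDF (u * τ / (1 + τ)) (τ / (1 + τ)) x := by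
    have normalization : (√(2 * Real.pi * τ))⁻¹
        = (√(1 + (τ : ℝ)))⁻¹ * (√(2 * Real.pi * (τ / (1 + τ))))⁻¹ := by
      rw [← mul_inv, ← Real.sqrt_mul hone.le]
      congr 2
      field_simp
    have exponent : -(x - 0) ^ 2 / (2 * τ) + (u ^ 2 / (1 + τ) - (u - x) ^ 2) / 2
        = -(x - u * τ / (1 + τ)) ^ 2 / (2 * (τ / (1 + τ))) := by
      field_simp
      ring
    simp only [gaussianPDF, gaussianPDFReal, NNReal.coe_div, NNReal.coe_add, NNReal.coe_one]
    rw [← ENNReal.ofReal_mul (by positivity), ← ENNReal.ofReal_mul (by positivity), mul_assoc,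
      ← Real.exp_add, exponent, normalization, mul_assoc]
  rw [gaussianReal_of_var_ne_zero _ hτ,
    lintegral_withDensity_eq_lintegral_mul _ (measurable_gaussianPDF _ _) (by fun_prop)]
  simp only [Pi.mul_apply, tilt]
  rw [lintegral_const_mul _ (measurable_gaussianPDF _ _),
    lintegral_gaussianPDF_eq_one _ (div_ne_zero hτ (by positivity)), mul_one]

theorem lintegral_exp_sub_sq_of_indepFun {Ω : Type*} [MeasurableSpace Ω] {μ : Measure Ω}
    [IsProbabilityMeasure μ] {U V : Ω → ℝ} (hU : Measurable U) (hV : Measurable V)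
    (hUV : IndepFun U V μ) {τ : ℝ≥0} (hτ : τ ≠ 0) (law : μ.map V = gaussianReal 0 τ) :
    ∫⁻ ω, ENNReal.ofReal (Real.exp ((U ω ^ 2 / (1 + τ) - (U ω - V ω) ^ 2) / 2)) ∂μ
      = ENNReal.ofReal (√(1 + τ))⁻¹ := by
  have := Measure.isProbabilityMeasure_map (μ := μ) hU.aemeasurable
  have joint := hUV.map_prod_eq_prod_map_map hU.aemeasurable hV.aemeasurable
  let G : ℝ × ℝ → ℝ≥0∞ := fun p =>
    ENNReal.ofReal (Real.exp ((p.1 ^ 2 / (1 + τ) - (p.1 - p.2) ^ 2) / 2))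
  have hG : Measurable G := by fun_prop
  calc ∫⁻ ω, G (U ω, V ω) ∂μ = ∫⁻ p, G p ∂(μ.map U).prod (gaussianReal 0 τ) := by
        rw [← law, ← joint, lintegral_map hG (by fun_prop)]
    _ = ∫⁻ u, ENNReal.ofReal (√(1 + τ))⁻¹ ∂μ.map U := by
        rw [lintegral_prod _ hG.aemeasurable]
        exact lintegral_congr (lintegral_exp_sub_sq_gaussianReal hτ)
    _ = ENNReal.ofReal (√(1 + τ))⁻¹ := by simp

theorem pi_sum_nonneg_le {Ω ι : Type*} [MeasurableSpace Ω] [Fintype ι] (μ : Measure Ω)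
    [IsProbabilityMeasure μ] {f : Ω → ℝ} (hf : Measurable f) :
    (Measure.pi fun _ : ι => μ) {x | 0 ≤ ∑ k, f (x k)}
      ≤ (∫⁻ x, ENNReal.ofReal (Real.exp (f x)) ∂μ) ^ Fintype.card ι := by
  let e : Ω → ℝ≥0∞ := fun ω => ENNReal.ofReal (Real.exp (f ω))
  have he : Measurable e := by fun_prop
  have set_eq : {x : ι → Ω | 0 ≤ ∑ k, f (x k)} = {x | 1 ≤ ∏ k, e (x k)} := by
    ext x
    simp only [e, Set.mem_ofPred_eq, ← Real.exp_sum, ENNReal.one_le_ofReal, Real.one_le_exp_iff,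
      ← ENNReal.ofReal_prod_of_nonneg fun _ _ => (Real.exp_pos _).le]
  calc (Measure.pi fun _ : ι => μ) {x | 0 ≤ ∑ k, f (x k)}
      ≤ ∫⁻ x, ∏ k, e (x k) ∂Measure.pi fun _ => μ := by
        rw [set_eq]
        simpa using mul_meas_ge_le_lintegral
          (Finset.measurable_prod _ fun k _ => he.comp (measurable_pi_apply k)) 1
    _ = (∫⁻ ω, e ω ∂μ) ^ Fintype.card ι := by
        rw [lintegral_prod_eq_prod_lintegral_of_indepFun Finset.univ _
          (iIndepFun_pi (X := fun _ => e) fun _ => he.aemeasurable)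
          fun k => he.comp (measurable_pi_apply k)]
        simp only [(measurePreserving_eval (fun _ : ι => μ) _).lintegral_comp he,
          Finset.prod_const, Finset.card_univ]

/-- The exponential base of the probability that a competitor explains the received block: the
codewords in which it differs contribute a Gaussian signal of power `v`, and typicality is tested
up to a relative deviation `ε`. -/
noncomputable def confusionBase (ε v : ℝ) : ℝ := Real.exp ε * (√(1 + v))⁻¹

theorem pi_confusion_le {Ω : Type*} [MeasurableSpace Ω] {μ : Measure Ω} [IsProbabilityMeasure μ]
    {U V : Ω → ℝ} (hU : Measurable U) (hV : Measurable V) {τ : ℝ} (hτ : 0 ≤ τ)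
    (hUV : ∫⁻ ω, ENNReal.ofReal (Real.exp ((U ω ^ 2 / (1 + τ) - (U ω - V ω) ^ 2) / 2)) ∂μ
      = ENNReal.ofReal (√(1 + τ))⁻¹) (ε : ℝ) (ℓ : ℕ) :
    (Measure.pi fun _ : Fin ℓ => μ) {x | ℓ * ((1 + τ) * (1 - ε)) ≤ ∑ k, U (x k) ^ 2 ∧
        ∑ k, (U (x k) - V (x k)) ^ 2 ≤ ℓ * (1 + ε)}
      ≤ ENNReal.ofReal (confusionBase ε τ) ^ ℓ := by
  have hone : 0 < 1 + τ := by positivity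
  have chernoff := pi_sum_nonneg_le (ι := Fin ℓ) μ
    (f := fun ω => ε + (U ω ^ 2 / (1 + τ) - (U ω - V ω) ^ 2) / 2) (by fun_prop)
  simp_rw [Real.exp_add, ENNReal.ofReal_mul (Real.exp_pos ε).le] at chernoff
  rw [lintegral_const_mul _ (by fun_prop), hUV, Fintype.card_fin,
    ← ENNReal.ofReal_mul (Real.exp_pos ε).le] at chernoff
  refine (measure_mono (Set.ofPred_subset_ofPred.2 fun x ⟨hsignal, hresidual⟩ => ?_)).trans chernoff
  have hscaled : ℓ * (1 - ε) ≤ (∑ k, U (x k) ^ 2) / (1 + τ) := by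
    rw [le_div_iff₀ hone]
    linarith [hsignal]
  simp only [Finset.sum_add_distrib, ← Finset.sum_div, Finset.sum_sub_distrib,
    Finset.sum_const, Finset.card_univ, Fintype.card_fin, nsmul_eq_mul]
  linarith [hresidual]

end GaussianTilt

section LinearForms

variable {C : Type*} [Fintype C] (q : ℝ≥0) (a : C → ℝ)

theorem map_sum_mul_pi_gaussianReal (s : Finset C) :
    (Measure.pi fun _ : C => gaussianReal 0 q).map (fun x => ∑ c ∈ s, a c * x c)
      = gaussianReal 0 ((∑ c ∈ s, ‖a c‖₊ ^ 2) * q) := by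
  classical
  induction s using Finset.induction_on with
  | empty => simp [Measure.map_const]
  | insert c s hc ih =>
    have indep : iIndepFun (fun (c : C) (x : C → ℝ) => a c * x c)
        (Measure.pi fun _ : C => gaussianReal 0 q) :=
      iIndepFun_pi (X := fun c x => a c * x) fun _ => by fun_prop
    have law_new : (Measure.pi fun _ : C => gaussianReal 0 q).map (fun x => a c * x c)
        = gaussianReal 0 (‖a c‖₊ ^ 2 * q) := by
      rw [← Function.comp_def (a c * ·), ← Measure.map_map (by fun_prop) (by fun_prop),
        (measurePreserving_eval (fun _ : C => gaussianReal 0 q) c).map_eq,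
        gaussianReal_map_const_mul, mul_zero]
      congr 2
      ext
      simp
    have law_sum := gaussianReal_add_gaussianReal_of_indepFun
      (indep.indepFun_finsetSum_of_notMem (fun c => by fun_prop) hc)
      (by rw [Finset.sum_fn]; exact ih) law_new
    rw [add_zero, ← add_mul, Finset.sum_fn] at law_sum
    simpa only [Finset.sum_insert hc, add_comm, Pi.add_def] using law_sum

theorem indepFun_sum_mul_pi_gaussianReal {s t : Finset C} (hst : Disjoint s t) :
    IndepFun (fun x => ∑ c ∈ s, a c * x c) (fun x => ∑ c ∈ t, a c * x c)
      (Measure.pi fun _ : C => gaussianReal 0 q) := by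
  have coords : iIndepFun (fun (c : C) (x : C → ℝ) => x c)
      (Measure.pi fun _ : C => gaussianReal 0 q) :=
    iIndepFun_pi (X := fun _ x => x) fun _ => aemeasurable_id
  have forms := (coords.indepFun_finset s t hst fun c => measurable_pi_apply c).comp
    (φ := fun y => ∑ c : s, a c * y c) (ψ := fun y => ∑ c : t, a c * y c)
    (by fun_prop) (by fun_prop)
  simpa only [Function.comp_def, Finset.sum_coe_sort _ fun c => a c * _] using forms

/-- The law of one channel use with random codebooks: independent Gaussian symbols of variance `q`,
one for each codeword, and standard Gaussian noise. -/
noncomputable def symbolLaw (C : Type*) [Fintype C] (q : ℝ≥0) : Measure ((C → ℝ) × ℝ) :=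
  (Measure.pi fun _ => gaussianReal 0 q).prod (gaussianReal 0 1)

instance : IsProbabilityMeasure (symbolLaw C q) := by
  unfold symbolLaw
  infer_instance

theorem map_codeword_symbolLaw (c : C) :
    (symbolLaw C q).map (fun p => p.1 c) = gaussianReal 0 q :=
  ((measurePreserving_eval (fun _ => gaussianReal 0 q) c).comp measurePreserving_fst).map_eq

theorem map_noise_symbolLaw : (symbolLaw C q).map Prod.snd = gaussianReal 0 1 :=
  measurePreserving_snd.map_eq

theorem map_sum_mul_add_noise_symbolLaw (s : Finset C) :
    (symbolLaw C q).map (fun p => ∑ c ∈ s, a c * p.1 c + p.2)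
      = gaussianReal 0 (1 + (∑ c ∈ s, ‖a c‖₊ ^ 2) * q) := by
  have law_sum : (symbolLaw C q).map (fun p => ∑ c ∈ s, a c * p.1 c)
      = gaussianReal 0 ((∑ c ∈ s, ‖a c‖₊ ^ 2) * q) := by
    rw [← map_sum_mul_pi_gaussianReal]
    exact ((Measurable.measurePreserving (f := fun x : C → ℝ => ∑ c ∈ s, a c * x c)
      (by fun_prop) _).comp measurePreserving_fst).map_eq
  have total := gaussianReal_add_gaussianReal_of_indepFun
    (indepFun_prod (X := fun x : C → ℝ => ∑ c ∈ s, a c * x c) (by fun_prop) measurable_id)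
    law_sum (map_noise_symbolLaw q)
  rwa [add_zero, add_comm _ (1 : ℝ≥0)] at total

theorem lintegral_exp_competitor_symbolLaw {s t : Finset C} (hst : Disjoint s t) {τ : ℝ≥0}
    (hτ : τ ≠ 0) (ht : τ = (∑ c ∈ t, ‖a c‖₊ ^ 2) * q) :
    ∫⁻ p, ENNReal.ofReal (Real.exp (((∑ c ∈ s, a c * p.1 c + p.2) ^ 2 / (1 + τ)
        - (∑ c ∈ s, a c * p.1 c + p.2 - ∑ c ∈ t, a c * p.1 c) ^ 2) / 2)) ∂symbolLaw C q
      = ENNReal.ofReal (√(1 + τ))⁻¹ := by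
  rw [symbolLaw, lintegral_prod_symm _ (by fun_prop)]
  have given_noise (z : ℝ) := lintegral_exp_sub_sq_of_indepFun
    (U := fun x : C → ℝ => ∑ c ∈ s, a c * x c + z) (by fun_prop) (by fun_prop)
    ((indepFun_sum_mul_pi_gaussianReal q a hst).comp (φ := (· + z)) (by fun_prop) measurable_id)
    hτ (ht ▸ map_sum_mul_pi_gaussianReal q a t)
  simp only [Function.comp_def, id] at given_noise
  simp only [given_noise, lintegral_const, measure_univ, mul_one]

end LinearForms

section JointDecoding

variable {ι W : Type*} {V : ι → Type*} (π : (j : ι) → W → V j)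

/-- The codewords that encode the message `w`: encoder `j` sees the part `π j w` of the message, and
a codeword is labelled by an encoder and what that encoder sees. -/
def codewordsOf (w : W) : ι ↪ Σ j, V j :=
  ⟨fun j => ⟨j, π j w⟩, fun _ _ h => congrArg Sigma.fst h⟩

theorem codewordsOf_apply (w : W) (j : ι) : codewordsOf π w j = ⟨j, π j w⟩ := rfl

theorem sum_nnnorm_sq_map_codewordsOf (g : ι → ℝ) (S : Finset ι) (w : W) :
    ∑ c ∈ S.map (codewordsOf π w), ‖g c.1‖₊ ^ 2 = ∑ j ∈ S, ‖g j‖₊ ^ 2 := by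
  simp only [Finset.sum_map, codewordsOf_apply]

variable [Fintype ι]

open Classical in
/-- The encoders that distinguish the messages `w` and `w'`. -/
noncomputable def diffSet (w w' : W) : Finset ι := {j | π j w ≠ π j w'}

theorem mem_diffSet {w w' : W} {j : ι} : j ∈ diffSet π w w' ↔ π j w ≠ π j w' := by
  simp [diffSet]

theorem disjoint_map_codewordsOf (w w' : W) :
    Disjoint ((diffSet π w w').map (codewordsOf π w))
      ((diffSet π w w').map (codewordsOf π w')) := by
  simp only [Finset.disjoint_left, Finset.mem_map, not_exists, not_and]
  rintro _ ⟨j, hj, rfl⟩ i - hij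
  obtain rfl : i = j := congrArg Sigma.fst hij
  exact mem_diffSet π |>.1 hj (eq_of_heq (Sigma.mk.inj hij).2).symm

/-- One symbol of the noiseless superposition of the codewords of `w`, received with gains `g`. -/
noncomputable def signal (g : ι → ℝ) (x : (Σ j, V j) → ℝ) (w : W) : ℝ := ∑ j, g j * x ⟨j, π j w⟩

theorem signal_add_sub_signal (g : ι → ℝ) (x : (Σ j, V j) → ℝ) (z : ℝ) (w w' : W) :
    signal π g x w + z - signal π g x w'
      = ∑ c ∈ (diffSet π w w').map (codewordsOf π w), g c.1 * x c + z
        - ∑ c ∈ (diffSet π w w').map (codewordsOf π w'), g c.1 * x c := by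
  have common : ∑ j, (g j * x ⟨j, π j w⟩ - g j * x ⟨j, π j w'⟩)
      = ∑ j ∈ diffSet π w w', (g j * x ⟨j, π j w⟩ - g j * x ⟨j, π j w'⟩) := by
    refine (Finset.sum_subset (Finset.subset_univ _) fun j _ hj => ?_).symm
    rw [not_not.1 (mt (mem_diffSet π).2 hj), sub_self]
  simp only [Finset.sum_sub_distrib] at common
  simp only [signal, Finset.sum_map, codewordsOf_apply]
  linarith

/-- The received block `y` is explained by the message `w`, up to noise of average power
`1 + ε`. -/
def Explains {ℓ : ℕ} (ε : ℝ) (g : ι → ℝ) (X : Fin ℓ → (Σ j, V j) → ℝ) (y : Fin ℓ → ℝ) (w : W) :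
    Prop :=
  ∑ k, (y k - signal π g (X k) w) ^ 2 ≤ ℓ * (1 + ε)

theorem measurable_explains {Ω : Type*} [MeasurableSpace Ω] {ℓ : ℕ} (ε : ℝ) (g : ι → ℝ)
    {X : Ω → Fin ℓ → (Σ j, V j) → ℝ} (hX : Measurable X) {y : Ω → Fin ℓ → ℝ} (hy : Measurable y) :
    Measurable fun ω => Explains π ε g (X ω) (y ω) := by
  refine measurable_pi_iff.2 fun w => measurableSet_setOfPred.1 ?_
  have (k : Fin ℓ) (c : Σ j, V j) : Measurable fun ω => X ω k c := by fun_prop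
  exact measurableSet_le (by unfold signal; fun_prop) measurable_const

variable {Side : Type*} (σ : W → Side)

/-- The joint decoder of a receiver with gains `g` that knows `σ w`: it looks for a message that is
consistent with this side information and explains the received block. The choice is arbitrary if
there is no such message or more than one. -/
noncomputable def jointDecoder [Nonempty W] {ℓ : ℕ} (ε : ℝ) (g : ι → ℝ)
    (X : Fin ℓ → (Σ j, V j) → ℝ) (y : Fin ℓ → ℝ) (s : Side) : W :=
  Classical.epsilon fun w => σ w = s ∧ Explains π ε g X y w

theorem exists_explains_of_jointDecoder_ne [Nonempty W] (hπ : Function.Injective fun w j => π j w)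
    {ℓ : ℕ} {ε : ℝ} {g : ι → ℝ} {X : Fin ℓ → (Σ j, V j) → ℝ} {y : Fin ℓ → ℝ} {w : W}
    (hw : Explains π ε g X y w) (error : jointDecoder π σ ε g X y (σ w) ≠ w) :
    ∃ w', σ w' = σ w ∧ (diffSet π w w').Nonempty ∧ Explains π ε g X y w' := by
  have chosen := Classical.epsilon_spec (p := fun w' => σ w' = σ w ∧ Explains π ε g X y w')
    ⟨w, rfl, hw⟩
  obtain ⟨j, hj⟩ := Function.ne_iff.1 (hπ.ne error)
  exact ⟨_, chosen.1, ⟨j, (mem_diffSet π).2 (Ne.symm hj)⟩, chosen.2⟩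

theorem measurable_jointDecoder [Nonempty W] [Finite W] [MeasurableSpace W] {Ω : Type*}
    [MeasurableSpace Ω] {ℓ : ℕ} (ε : ℝ) (g : ι → ℝ) {X : Ω → Fin ℓ → (Σ j, V j) → ℝ}
    (hX : Measurable X) {y : Ω → Fin ℓ → ℝ} (hy : Measurable y) (s : Side) :
    Measurable fun ω => jointDecoder π σ ε g (X ω) (y ω) s :=
  (measurable_of_finite fun E : W → Prop => Classical.epsilon fun w => σ w = s ∧ E w).comp
    (measurable_explains π ε g hX hy)

/-- With codebooks `p.1` and noise `p.2`, a codeword of the message `w` violates the power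
constraint or the joint decoder errs. -/
def randomError [Nonempty W] (ε : ℝ) (q : ℝ≥0) (g : ι → ℝ) (ℓ : ℕ) (w : W) :
    Set ((Fin ℓ → (Σ j, V j) → ℝ) × (Fin ℓ → ℝ)) :=
  {p | ∃ j, ℓ * (q * (1 + ε)) < ∑ k, p.1 k ⟨j, π j w⟩ ^ 2} ∪
  {p | jointDecoder π σ ε g p.1 (fun k => signal π g (p.1 k) w + p.2 k) (σ w) ≠ w}

theorem measurableSet_randomError [Nonempty W] [Finite W] (ε : ℝ) (q : ℝ≥0)
    (g : ι → ℝ) (ℓ : ℕ) (w : W) : MeasurableSet (randomError π σ ε q g ℓ w) := by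
  let : MeasurableSpace W := ⊤
  have (k : Fin ℓ) (c : Σ j, V j) :
      Measurable fun p : (Fin ℓ → (Σ j, V j) → ℝ) × (Fin ℓ → ℝ) => p.1 k c := by fun_prop
  refine .union ?_ (measurableSet_eq_fun (measurable_jointDecoder π σ ε g measurable_fst ?_ _)
    measurable_const).compl
  · simp only [Set.ofPred_exists]
    exact .iUnion fun j => measurableSet_lt measurable_const (by fun_prop)
  · unfold signal
    fun_prop

variable [∀ j, Fintype (V j)] {ℓ : ℕ} (q : ℝ≥0) (g : ι → ℝ) (ε : ℝ)

theorem pi_not_explains_le (w : W) :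
    (Measure.pi fun _ : Fin ℓ => symbolLaw (Σ j, V j) q)
        {ω | ¬ Explains π ε g (fun k => (ω k).1) (fun k => signal π g (ω k).1 w + (ω k).2) w}
      ≤ sqDeviation ε ℓ := by
  simpa [Explains] using
    pi_lt_sum_sq_le one_ne_zero measurable_snd (map_noise_symbolLaw (C := Σ j, V j) q) ε ℓ

variable {q g} in
theorem pi_explains_competitor_le (hq : q ≠ 0) (hg : ∀ j, g j ≠ 0) {w w' : W}
    (hne : (diffSet π w w').Nonempty) :
    (Measure.pi fun _ : Fin ℓ => symbolLaw (Σ j, V j) q)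
        {ω | ℓ * ((1 + (∑ j ∈ diffSet π w w', g j ^ 2) * q) * (1 - ε))
            ≤ ∑ k, (∑ c ∈ (diffSet π w w').map (codewordsOf π w), g c.1 * (ω k).1 c
              + (ω k).2) ^ 2 ∧
          Explains π ε g (fun k => (ω k).1) (fun k => signal π g (ω k).1 w + (ω k).2) w'}
      ≤ ENNReal.ofReal (confusionBase ε ((∑ j ∈ diffSet π w w', g j ^ 2) * q)) ^ ℓ := by
  have hτ : (∑ j ∈ diffSet π w w', ‖g j‖₊ ^ 2) * q ≠ 0 :=
    mul_ne_zero (Finset.sum_pos (fun j _ => by simpa [pos_iff_ne_zero] using hg j) hne).ne' hq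
  have hcoe : ((∑ j ∈ diffSet π w w', ‖g j‖₊ ^ 2 : ℝ≥0) : ℝ) = ∑ j ∈ diffSet π w w', g j ^ 2 := by
    simp
  have tilted := lintegral_exp_competitor_symbolLaw q (fun c => g c.1)
    (disjoint_map_codewordsOf π w w') hτ (by rw [sum_nnnorm_sq_map_codewordsOf])
  simp only [Explains, signal_add_sub_signal]
  rw [NNReal.coe_mul, hcoe] at tilted
  exact pi_confusion_le (by fun_prop) (by fun_prop) (by positivity) tilted ε ℓ

theorem pi_signal_power_lt_le (S : Finset ι) (w : W) :
    (Measure.pi fun _ : Fin ℓ => symbolLaw (Σ j, V j) q)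
        {ω | ∑ k, (∑ c ∈ S.map (codewordsOf π w), g c.1 * (ω k).1 c + (ω k).2) ^ 2
          < ℓ * ((1 + (∑ j ∈ S, g j ^ 2) * q) * (1 - ε))}
      ≤ sqDeviation ε ℓ := by
  have tail := pi_sum_sq_lt_le (by positivity) (by fun_prop)
    (map_sum_mul_add_noise_symbolLaw q (fun c => g c.1) (S.map (codewordsOf π w))) ε ℓ
  simpa only [sum_nnnorm_sq_map_codewordsOf, NNReal.coe_add, NNReal.coe_one, NNReal.coe_mul,
    NNReal.coe_sum, NNReal.coe_pow, coe_nnnorm, Real.norm_eq_abs, sq_abs] using tail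

end JointDecoding

section RandomCoding

variable {ι W Side : Type*} [Fintype ι] [Finite W] [Nonempty W] {V : ι → Type*}
  [∀ j, Fintype (V j)] (π : (j : ι) → W → V j) (σ : W → Side)

/-- A bound for the error probability of the joint decoder when the messages that differ from the
correct one exactly at the encoders in `S` number at most `N S`. -/
noncomputable def jointDecodingBound (ε : ℝ) (q : ℝ≥0) (g : ι → ℝ) (N : Finset ι → ℕ) (ℓ : ℕ) :
    ℝ≥0∞ :=
  sqDeviation ε ℓ + ∑ S : Finset ι with S.Nonempty, (sqDeviation ε ℓ
    + N S * ENNReal.ofReal (confusionBase ε ((∑ j ∈ S, g j ^ 2) * q)) ^ ℓ)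

open Classical in
theorem pi_jointDecoder_ne_le (hπ : Function.Injective fun w j => π j w) {g : ι → ℝ}
    (hg : ∀ j, g j ≠ 0) {N : Finset ι → ℕ} {w : W}
    (hN : ∀ S : Finset ι, S.Nonempty →
      Set.ncard {w' | σ w' = σ w ∧ diffSet π w w' = S} ≤ N S)
    (ε : ℝ) {q : ℝ≥0} (hq : q ≠ 0) (ℓ : ℕ) :
    (Measure.pi fun _ : Fin ℓ => symbolLaw (Σ j, V j) q)
        {ω | jointDecoder π σ ε g (fun k => (ω k).1)
          (fun k => signal π g (ω k).1 w + (ω k).2) (σ w) ≠ w}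
      ≤ jointDecodingBound ε q g N ℓ := by
  cases nonempty_fintype W
  let X (ω : Fin ℓ → ((Σ j, V j) → ℝ) × ℝ) (k : Fin ℓ) := (ω k).1
  let y (ω : Fin ℓ → ((Σ j, V j) → ℝ) × ℝ) (k : Fin ℓ) := signal π g (ω k).1 w + (ω k).2
  let power (S : Finset ι) (ω : Fin ℓ → ((Σ j, V j) → ℝ) × ℝ) : ℝ :=
    ∑ k, (∑ c ∈ S.map (codewordsOf π w), g c.1 * (ω k).1 c + (ω k).2) ^ 2
  let typical (S : Finset ι) : ℝ := ℓ * ((1 + (∑ j ∈ S, g j ^ 2) * q) * (1 - ε))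
  let competitors (S : Finset ι) : Finset W := Set.toFinset {w' | σ w' = σ w ∧ diffSet π w w' = S}
  have union_bound : {ω | jointDecoder π σ ε g (X ω) (y ω) (σ w) ≠ w} ⊆
      {ω | ¬ Explains π ε g (X ω) (y ω) w} ∪ ⋃ S ∈ Finset.univ.filter Finset.Nonempty,
        ({ω | power S ω < typical S} ∪ ⋃ w' ∈ competitors S,
          {ω | typical S ≤ power S ω ∧ Explains π ε g (X ω) (y ω) w'}) := by
    intro ω error
    by_contra hω
    simp only [Set.mem_union, Set.mem_iUnion, Set.mem_ofPred_eq, not_or, not_exists, not_not,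
      not_lt, not_and] at hω
    obtain ⟨w', side, nonempty, explains⟩ := exists_explains_of_jointDecoder_ne π σ hπ hω.1 error
    exact (hω.2 _ (by simpa using nonempty)).2 w' (by simpa [competitors] using side)
      (hω.2 _ (by simpa using nonempty)).1 explains
  refine (measure_mono union_bound).trans ((measure_union_le _ _).trans
    (add_le_add (pi_not_explains_le π q g ε w) ((measure_biUnion_finset_le _ _).trans
      (Finset.sum_le_sum fun S hS => (measure_union_le _ _).trans
        (add_le_add (pi_signal_power_lt_le π q g ε S w) ?_)))))
  have nonempty : S.Nonempty := (Finset.mem_filter.1 hS).2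
  refine (measure_biUnion_finset_le _ _).trans ((Finset.sum_le_card_nsmul _ _ _
    fun w' hw' => ?_).trans (nsmul_eq_mul _ _ |>.trans_le
      (mul_le_mul_left (Nat.cast_le.2 ((Set.ncard_eq_toFinset_card' _).symm.trans_le
        (hN S nonempty))) _)))
  obtain rfl : diffSet π w w' = S := (Set.mem_toFinset.1 hw').2
  exact pi_explains_competitor_le π ε hq hg nonempty

/-- The law of the noise at one receiver during a block of length `ℓ`. -/
noncomputable def blockNoise (ℓ : ℕ) : Measure (Fin ℓ → ℝ) :=
  Measure.pi fun _ => gaussianReal 0 1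

instance (ℓ : ℕ) : IsProbabilityMeasure (blockNoise ℓ) := by
  unfold blockNoise
  infer_instance

/-- The law of Gaussian random codebooks of length `ℓ` for the codewords in `C`. -/
noncomputable def codebookLaw (C : Type*) [Fintype C] (q : ℝ≥0) (ℓ : ℕ) :
    Measure (Fin ℓ → C → ℝ) :=
  Measure.pi fun _ => Measure.pi fun _ => gaussianReal 0 q

instance (C : Type*) [Fintype C] (q : ℝ≥0) (ℓ : ℕ) : IsProbabilityMeasure (codebookLaw C q ℓ) := by
  unfold codebookLaw
  infer_instance

theorem measurePreserving_symbolLaw_codebookLaw (C : Type*) [Fintype C] (q : ℝ≥0) (ℓ : ℕ) :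
    MeasurePreserving (MeasurableEquiv.arrowProdEquivProdArrow (C → ℝ) ℝ (Fin ℓ))
      (Measure.pi fun _ => symbolLaw C q) ((codebookLaw C q ℓ).prod (blockNoise ℓ)) :=
  measurePreserving_arrowProdEquivProdArrow _ _ _ _ _

/-- The bound for the probability that, with random codebooks, a codeword of the message violates
the power constraint or the joint decoder errs. -/
noncomputable def randomCodingBound (ε : ℝ) (q : ℝ≥0) (g : ι → ℝ) (N : Finset ι → ℕ) (ℓ : ℕ) :
    ℝ≥0∞ :=
  Fintype.card ι * sqDeviation ε ℓ + jointDecodingBound ε q g N ℓ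

theorem prod_randomError_le (hπ : Function.Injective fun w j => π j w) {g : ι → ℝ}
    (hg : ∀ j, g j ≠ 0) {N : Finset ι → ℕ} {w : W}
    (hN : ∀ S : Finset ι, S.Nonempty →
      Set.ncard {w' | σ w' = σ w ∧ diffSet π w w' = S} ≤ N S)
    (ε : ℝ) {q : ℝ≥0} (hq : q ≠ 0) (ℓ : ℕ) :
    ((codebookLaw (Σ j, V j) q ℓ).prod (blockNoise ℓ)) (randomError π σ ε q g ℓ w)
      ≤ randomCodingBound ε q g N ℓ := by
  rw [← (measurePreserving_symbolLaw_codebookLaw (Σ j, V j) q ℓ).measure_preimage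
    (measurableSet_randomError π σ ε q g ℓ w).nullMeasurableSet]
  refine (measure_union_le _ _).trans (add_le_add ?_ (pi_jointDecoder_ne_le π σ hπ hg hN ε hq ℓ))
  have union : {ω : Fin ℓ → ((Σ j, V j) → ℝ) × ℝ |
      ∃ j, ℓ * (q * (1 + ε)) < ∑ k, (ω k).1 ⟨j, π j w⟩ ^ 2}
      = ⋃ j, {ω | ℓ * (q * (1 + ε)) < ∑ k, (ω k).1 ⟨j, π j w⟩ ^ 2} := Set.ofPred_exists _
  refine (measure_mono union.subset).trans ((measure_iUnion_fintype_le _ _).trans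
    ((Finset.sum_le_card_nsmul _ _ _ fun j _ => pi_lt_sum_sq_le hq (by fun_prop)
      (map_codeword_symbolLaw q _) ε ℓ).trans_eq ?_))
  rw [nsmul_eq_mul, Finset.card_univ]

theorem exists_sum_measure_section_le {α β T : Type*} [MeasurableSpace α] [MeasurableSpace β]
    [Fintype T] (μ : Measure α) (ν : Measure β) [IsProbabilityMeasure μ] [SFinite ν]
    {bad : T → Set (α × β)} (measurable_bad : ∀ t, MeasurableSet (bad t)) :
    ∃ X, ∑ t, ν (Prod.mk X ⁻¹' bad t) ≤ ∑ t, (μ.prod ν) (bad t) := by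
  have measurable_section (t : T) : Measurable fun X => ν (Prod.mk X ⁻¹' bad t) :=
    measurable_measure_prodMk_left (measurable_bad t)
  obtain ⟨X, hX⟩ := exists_le_lintegral (μ := μ)
    (Finset.measurable_sum Finset.univ fun t _ => measurable_section t).aemeasurable
  refine ⟨X, hX.trans_eq ?_⟩
  rw [lintegral_finsetSum _ fun t _ => measurable_section t]
  exact Finset.sum_congr rfl fun t _ => (Measure.prod_apply (measurable_bad t)).symm

end RandomCoding

theorem exists_codebook {ι W R Θ : Type*} [Fintype ι] [Finite W] [Nonempty W] [MeasurableSpace W]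
    [Fintype R] [Fintype Θ] {V : ι → Type*} [∀ j, Finite (V j)] {π : (j : ι) → W → V j}
    (hπ : Function.Injective fun w j => π j w) {Side : R → Type*} (σ : (r : R) → W → Side r)
    {g : R → ι → ℝ} (hg : ∀ r j, g r j ≠ 0) {N : R → Finset ι → ℕ}
    (hN : ∀ r w, ∀ S : Finset ι, S.Nonempty →
      Set.ncard {w' | σ r w' = σ r w ∧ diffSet π w w' = S} ≤ N r S)
    (w : Θ → W) {ε : ℝ} (hε : 0 ≤ ε) {q : ℝ≥0} (hq : q ≠ 0) (ℓ : ℕ) :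
    ∃ (x : (j : ι) → V j → Fin ℓ → ℝ) (D : (r : R) → (Fin ℓ → ℝ) → Side r → W),
      (∀ j v, ∑ k, x j v k ^ 2 ≤ ℓ * (q * (1 + ε))) ∧ (∀ r s, Measurable fun y => D r y s) ∧
      ∑ t : Θ × R, blockNoise ℓ {ζ | D t.2 (fun k => ∑ j, g t.2 j * x j (π j (w t.1)) k + ζ k)
          (σ t.2 (w t.1)) ≠ w t.1}
        ≤ ∑ t : Θ × R, randomCodingBound ε q (g t.2) (N t.2) ℓ := by
  have (j : ι) := Fintype.ofFinite (V j)
  obtain ⟨X, hX⟩ := exists_sum_measure_section_le (codebookLaw (Σ j, V j) q ℓ) (blockNoise ℓ)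
    (bad := fun t : Θ × R => randomError π (σ t.2) ε q (g t.2) ℓ (w t.1))
    fun t => measurableSet_randomError ..
  let good (j : ι) (v : V j) : Prop := ∑ k, X k ⟨j, v⟩ ^ 2 ≤ ℓ * (q * (1 + ε))
  refine ⟨fun j v k => if good j v then X k ⟨j, v⟩ else 0,
    fun r y s => jointDecoder π (σ r) ε (g r) X y s, fun j v => ?_, fun r s =>
    measurable_jointDecoder π (σ r) ε (g r) measurable_const measurable_id s, ?_⟩
  · by_cases hv : good j v
    · simpa only [if_pos hv] using hv
    · simpa only [if_neg hv, ne_eq, OfNat.ofNat_ne_zero, not_false_eq_true, zero_pow,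
        Finset.sum_const_zero] using by positivity
  · refine (Finset.sum_le_sum fun t _ => measure_mono fun ζ error => ?_).trans (hX.trans
      (Finset.sum_le_sum fun t _ => prod_randomError_le π (σ t.2) hπ (hg t.2) (hN t.2 _) ε hq ℓ))
    by_contra good_event
    simp only [randomError, Set.mem_preimage, Set.mem_union, Set.mem_ofPred_eq, not_or,
      not_exists, not_lt, not_not] at good_event
    refine error (Eq.trans ?_ good_event.2)
    simp only [signal, good, if_pos (good_event.1 _)]

section Blocks

theorem measurePreserving_pi_comp {ι κ α : Type*} [Fintype ι] [Fintype κ] [MeasurableSpace α]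
    (μ : Measure α) [IsProbabilityMeasure μ] {e : κ → ι} (he : Function.Injective e) :
    MeasurePreserving (fun (z : ι → α) k => z (e k)) (Measure.pi fun _ => μ)
      (Measure.pi fun _ => μ) := by
  have coords : iIndepFun (fun (i : ι) (z : ι → α) => z i) (Measure.pi fun _ : ι => μ) :=
    iIndepFun_pi (X := fun _ x => x) fun _ => aemeasurable_id
  refine ⟨by fun_prop, ((coords.precomp he).map_fun_eq_pi_map fun k =>
    (measurable_pi_apply _).aemeasurable).trans ?_⟩
  congr 1 with k : 1
  exact (measurePreserving_eval (fun _ : ι => μ) (e k)).map_eq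

theorem sum_fin_le_of_blocks {n ℓ D : ℕ} [NeZero ℓ] (v : ℕ → Fin ℓ → ℝ≥0∞) {U : ℝ≥0∞}
    (hv : ∀ b, ∑ k, v b k ≤ U) (hv_zero : ∀ b, D ≤ b → v b = 0) :
    ∑ i : Fin n, v (i / ℓ) (Fin.ofNat ℓ i) ≤ D * U := calc
  ∑ i : Fin n, v (i / ℓ) (Fin.ofNat ℓ i) = ∑ i ∈ Finset.range n, v (i / ℓ) (Fin.ofNat ℓ i) :=
    Fin.sum_univ_eq_sum_range (fun i => v (i / ℓ) (Fin.ofNat ℓ i)) n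
  _ ≤ ∑' i, v (i / ℓ) (Fin.ofNat ℓ i) := ENNReal.sum_le_tsum _
  _ = ∑' p : ℕ × Fin ℓ, v p.1 p.2 :=
    (Nat.divModEquiv ℓ).tsum_eq fun p : ℕ × Fin ℓ => v p.1 p.2
  _ = ∑' b, ∑ k, v b k := by simp only [ENNReal.tsum_prod, tsum_fintype]
  _ = ∑ b ∈ Finset.range D, ∑ k, v b k := tsum_eq_sum fun b hb => by
    rw [hv_zero b (by simpa using hb)]
    exact Finset.sum_const_zero
  _ ≤ D * U := by simpa using Finset.sum_le_card_nsmul (Finset.range D) _ U fun b _ => hv b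

theorem succ_block_index_lt {n ℓ B : ℕ} (fits : (B + 1) * ℓ ≤ n) (b : Fin B) (k : Fin ℓ) :
    (b + 1 : ℕ) * ℓ + k < n := by
  calc (b + 1 : ℕ) * ℓ + k < (b + 1) * ℓ + ℓ := by gcongr; exact k.2
    _ = (b + 1 + 1) * ℓ := (Nat.succ_mul _ _).symm
    _ ≤ (B + 1) * ℓ := by gcongr; exact b.2
    _ ≤ n := fits

end Blocks

section Received

variable {M : Pair → ℕ} {n : ℕ} (h : Fin 3 → ℝ) (c : Code M n) (m : Msgs M) (z : Noise n)

theorem received_fst (t : ℕ) (ht : t ≤ n) (i : Fin t) :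
    (received h c m z t ht).1 i
      = ∑ j, h j * userInput h c m z j (i.castLE ht) + z.1 (i.castLE ht) := by
  induction t with
  | zero => exact i.elim0
  | succ t ih =>
    cases i using Fin.lastCases with
    | last =>
      simp only [received, Fin.snoc_last]
      rfl
    | cast i =>
      simp only [received, Fin.snoc_castSucc]
      exact ih _ i

theorem received_snd (t : ℕ) (ht : t ≤ n) (j : Fin 3) (i : Fin t) :
    (received h c m z t ht).2 j i
      = h j * relayInput h c m z (i.castLE ht) + z.2 j (i.castLE ht) := by
  induction t with
  | zero => exact i.elim0
  | succ t ih =>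
    cases i using Fin.lastCases with
    | last =>
      simp only [received, Fin.snoc_last]
      rfl
    | cast i =>
      simp only [received, Fin.snoc_castSucc]
      exact ih _ i

end Received

namespace CDFCode

variable {M : Pair → ℕ} {n : ℕ} (s : CDFCode M n) (h : Fin 3 → ℝ) (m : Msgs M) (z : Noise n)

instance : NeZero s.ℓ := ⟨s.ℓ_pos.ne'⟩

/-- The submessages of block `b`. -/
def sub (b : Fin s.B) : Msgs s.K := fun p => s.split p (m p) b

/-- The noise at the relay in block `b`. -/
def relayNoise (b : Fin s.B) (k : Fin s.ℓ) : ℝ := z.1 ⟨b * s.ℓ + k, s.index_lt b k⟩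

/-- The noise at user `j` in block `b + 1`, where the relay forwards the submessages of block
`b`. -/
def userNoise (j : Fin 3) (b : Fin s.B) (k : Fin s.ℓ) : ℝ :=
  z.2 j ⟨(b + 1 : ℕ) * s.ℓ + k, succ_block_index_lt s.fits b k⟩

/-- What the relay receives in block `b`. -/
noncomputable def relayBlock (b : Fin s.B) (k : Fin s.ℓ) : ℝ :=
  (received h s.toCode m z n le_rfl).1 ⟨b * s.ℓ + k, s.index_lt b k⟩

/-- What user `j` sends in block `b`. -/
def userSends (j : Fin 3) (b : ℕ) : Fin s.ℓ → ℝ :=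
  if hb : b < s.B then s.userBook j (sent (s.sub m ⟨b, hb⟩) j) else 0

/-- What the relay sends in block `b`. -/
noncomputable def relaySends (b : ℕ) : Fin s.ℓ → ℝ :=
  if hb : 1 ≤ b ∧ b ≤ s.B then
    s.relayBook (s.relayDec (s.relayBlock h m z ⟨b - 1, by omega⟩)) else 0

theorem userInput_eq (j : Fin 3) (i : Fin n) :
    userInput h s.toCode m z j i = s.userSends m j (i / s.ℓ) (Fin.ofNat s.ℓ i) := by
  simp only [userInput, toCode, userSends]
  split_ifs <;> rfl

theorem relayInput_eq (i : Fin n) :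
    relayInput h s.toCode m z i = s.relaySends h m z (i / s.ℓ) (Fin.ofNat s.ℓ i) := by
  simp only [relayInput, toCode, relaySends]
  split_ifs
  · congr 2
    ext k
    simp only [relayBlock, received_fst]
    rfl
  · rfl

theorem relayBlock_eq (b : Fin s.B) (k : Fin s.ℓ) :
    s.relayBlock h m z b k
      = ∑ j, h j * s.userBook j (sent (s.sub m b) j) k + s.relayNoise z b k := by
  have position := Prod.ext_iff.1 ((Nat.divModEquiv s.ℓ).apply_symm_apply (b, k))
  simp only [Nat.divModEquiv_apply, Nat.divModEquiv_symm_apply] at position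
  simp only [relayBlock, received_fst, userInput_eq, Fin.castLE_mk, position.1, position.2,
    userSends, dif_pos b.2]
  rfl

theorem userBlock_eq (j : Fin 3) (b : Fin s.B) (k : Fin s.ℓ) :
    (received h s.toCode m z n le_rfl).2 j ⟨(b + 1 : ℕ) * s.ℓ + k, succ_block_index_lt s.fits b k⟩
      = h j * s.relayBook (s.relayDec (s.relayBlock h m z b)) k + s.userNoise z j b k := by
  have position := Prod.ext_iff.1 ((Nat.divModEquiv s.ℓ).apply_symm_apply (b + 1, k))
  simp only [Nat.divModEquiv_apply, Nat.divModEquiv_symm_apply] at position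
  have active : 1 ≤ (b + 1 : ℕ) ∧ (b + 1 : ℕ) ≤ s.B := ⟨by omega, b.2⟩
  simp only [received_snd, relayInput_eq, Fin.castLE_mk, position.1, position.2, relaySends,
    dif_pos active]
  rfl

theorem noiseLaw_relayNoise_le (b : Fin s.B) (E : Set (Fin s.ℓ → ℝ)) :
    noiseLaw n {z | s.relayNoise z b ∈ E} ≤ blockNoise s.ℓ E := by
  have law : MeasurePreserving (fun z => s.relayNoise z b) (noiseLaw n) (blockNoise s.ℓ) :=
    (measurePreserving_pi_comp (gaussianReal 0 1)
      (e := fun k : Fin s.ℓ => (⟨b * s.ℓ + k, s.index_lt b k⟩ : Fin n))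
      fun k k' hk => Fin.ext (by simpa using hk)).comp measurePreserving_fst
  exact (Measure.le_map_apply law.aemeasurable E).trans_eq (by rw [law.map_eq])

theorem noiseLaw_userNoise_le (j : Fin 3) (b : Fin s.B) (E : Set (Fin s.ℓ → ℝ)) :
    noiseLaw n {z | s.userNoise z j b ∈ E} ≤ blockNoise s.ℓ E := by
  have law : MeasurePreserving (fun z => s.userNoise z j b) (noiseLaw n) (blockNoise s.ℓ) :=
    (measurePreserving_pi_comp (gaussianReal 0 1)
      (e := fun k : Fin s.ℓ => (⟨(b + 1 : ℕ) * s.ℓ + k, succ_block_index_lt s.fits b k⟩ : Fin n))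
      fun k k' hk => Fin.ext (by simpa using hk)).comp
      ((measurePreserving_eval _ j).comp measurePreserving_snd)
  exact (Measure.le_map_apply law.aemeasurable E).trans_eq (by rw [law.map_eq])

end CDFCode

section Power

instance (n : ℕ) : IsProbabilityMeasure (noiseLaw n) := by
  unfold noiseLaw
  infer_instance

theorem sum_lintegral_le_lintegral_sum {α ι : Type*} [MeasurableSpace α] (μ : Measure α)
    (s : Finset ι) (f : ι → α → ℝ≥0∞) :
    ∑ i ∈ s, ∫⁻ x, f i x ∂μ ≤ ∫⁻ x, ∑ i ∈ s, f i x ∂μ := by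
  classical
  induction s using Finset.induction_on with
  | empty => simp
  | insert i s hi ih =>
    simp_rw [Finset.sum_insert hi]
    exact (add_le_add le_rfl ih).trans (le_lintegral_add _ _)

theorem sum_expect_le {M : Pair → ℕ} {n : ℕ} {ι : Type*} [Fintype ι]
    (X : ι → Msgs M → Noise n → ℝ≥0∞) {c : ℝ≥0∞} (hX : ∀ m z, ∑ i, X i m z ≤ c) :
    ∑ i, expect (X i) ≤ c := by
  have given_message (m : Msgs M) : ∑ i, ∫⁻ z, X i m z ∂noiseLaw n ≤ c :=
    (sum_lintegral_le_lintegral_sum _ _ _).trans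
      ((lintegral_mono fun z => hX m z).trans_eq (by simp))
  simp only [expect, div_eq_mul_inv]
  rw [← Finset.sum_mul, ← div_eq_mul_inv, Finset.sum_comm]
  refine ENNReal.div_le_of_le_mul ((Finset.sum_le_card_nsmul _ _ c fun m _ =>
    given_message m).trans_eq ?_)
  rw [nsmul_eq_mul, Finset.card_univ, mul_comm]

namespace CDFCode

variable {M : Pair → ℕ} {n : ℕ} (s : CDFCode M n)

theorem sum_expect_div_le {P : ℝ} (hP : 0 ≤ P) {x : Fin n → Msgs M → Noise n → ℝ}
    (v : Msgs M → Noise n → ℕ → Fin s.ℓ → ℝ)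
    (hx : ∀ i m z, x i m z = v m z (i / s.ℓ) (Fin.ofNat s.ℓ i))
    (hv : ∀ m z b, v m z b = 0 ∨ ∑ k, v m z b k ^ 2 ≤ s.ℓ * P)
    (hv_zero : ∀ m z b, s.B < b → v m z b = 0) :
    (∑ i, expect fun m z => ENNReal.ofReal (x i m z ^ 2)) / n ≤ ENNReal.ofReal P := by
  refine ENNReal.div_le_of_le_mul ((sum_expect_le _ fun m z => ?_).trans_eq (mul_comm _ _))
  have block_power (b : ℕ) :
      ∑ k, ENNReal.ofReal (v m z b k ^ 2) ≤ s.ℓ * ENNReal.ofReal P := by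
    rw [← ENNReal.ofReal_sum_of_nonneg fun k _ => sq_nonneg _, ← ENNReal.ofReal_natCast,
      ← ENNReal.ofReal_mul (by positivity)]
    refine ENNReal.ofReal_le_ofReal ?_
    rcases hv m z b with hb | hb
    · simpa [hb] using by positivity
    · exact hb
  simp only [hx]
  refine (sum_fin_le_of_blocks (fun b k => ENNReal.ofReal (v m z b k ^ 2)) (D := s.B + 1)
    block_power fun b hb => funext fun k => by simp [hv_zero m z b hb]).trans ?_
  rw [← mul_assoc]
  gcongr
  exact_mod_cast s.fits

theorem powerConstraint (h : Fin 3 → ℝ) {P : ℝ} (hP : 0 ≤ P)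
    (hu : ∀ j v, ∑ k, s.userBook j v k ^ 2 ≤ s.ℓ * P)
    (hr : ∀ w, ∑ k, s.relayBook w k ^ 2 ≤ s.ℓ * P) : PowerConstraint h P s.toCode := by
  refine ⟨fun j => s.sum_expect_div_le hP (fun m _ => s.userSends m j)
    (fun i m z => s.userInput_eq h m z j i) (fun m _ b => ?_) fun m _ b hb => dif_neg hb.le.not_gt,
    s.sum_expect_div_le hP (fun m z => s.relaySends h m z)
    (fun i m z => s.relayInput_eq h m z i) (fun m z b => ?_) fun m z b hb => dif_neg (by omega)⟩
  · unfold userSends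
    split_ifs
    exacts [.inr (hu _ _), .inl rfl]
  · unfold relaySends
    split_ifs
    exacts [.inr (hr _), .inl rfl]

end CDFCode

end Power

/-- The codebooks and decoders of a decode-and-forward scheme for one block of length `ℓ`, with
submessages in `Msgs K`. -/
structure BlockCode (K : Pair → ℕ) (ℓ : ℕ) where
  userBook : (j : Fin 3) → Sent K j → Fin ℓ → ℝ
  relayDec : (Fin ℓ → ℝ) → Msgs K
  relayBook : Msgs K → Fin ℓ → ℝ
  userDec : (j : Fin 3) → (Fin ℓ → ℝ) → Sent K j → Msgs K
  measurable_relayDec : Measurable relayDec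
  measurable_userDec : ∀ j v, Measurable fun y => userDec j y v

namespace BlockCode

variable {K : Pair → ℕ} {ℓ : ℕ} (c : BlockCode K ℓ) (h : Fin 3 → ℝ)

/-- The noise at the relay for which it fails to decode the submessages `t`. -/
def relayFails (t : Msgs K) : Set (Fin ℓ → ℝ) :=
  {ζ | c.relayDec (fun k => ∑ j, h j * c.userBook j (sent t j) k + ζ k) ≠ t}

/-- The noise at user `i` for which it fails to decode the submessages `t` sent by the relay. -/
def userFails (t : Msgs K) (i : Fin 3) : Set (Fin ℓ → ℝ) :=
  {ζ | c.userDec i (fun k => h i * c.relayBook t k + ζ k) (sent t i) ≠ t}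

variable {M : Pair → ℕ} {n B : ℕ} (hℓ : 0 < ℓ) (fits : (B + 1) * ℓ ≤ n)
  {split : (p : Pair) → Fin (M p) → Fin B → Fin (K p)}
  {merge : (p : Pair) → (Fin B → Fin (K p)) → Fin (M p)}
  (merge_split : ∀ p, Function.LeftInverse (merge p) (split p))

/-- The scheme that uses the block code `c` in every block. -/
def toCDFCode : CDFCode M n where
  ℓ := ℓ
  B := B
  ℓ_pos := hℓ
  fits := fits
  K := K
  split := split
  split_injective p := (merge_split p).injective
  userBook := c.userBook
  relayDec := c.relayDec
  relayBook := c.relayBook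
  dec j y v p := merge p.1 fun b =>
    c.userDec j (fun k => y ⟨(b + 1 : ℕ) * ℓ + k, succ_block_index_lt fits b k⟩)
      (fun p => split p.1 (v p) b) p.1
  measurable_relayDec := c.measurable_relayDec
  measurable_dec j v := (measurable_of_finite
      fun (t : Fin B → Msgs K) (p : {p : Pair // p.1.2 = j}) => merge p.1 fun b => t b p.1).comp
    (measurable_pi_lambda _ fun b => (c.measurable_userDec j _).comp (by fun_prop))

local notation "scheme" => c.toCDFCode hℓ fits merge_split

theorem relayDec_relayBlock {m : Msgs M} {z : Noise n} {b : Fin B}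
    (hb : (scheme).relayNoise z b ∉ c.relayFails h ((scheme).sub m b)) :
    c.relayDec ((scheme).relayBlock h m z b) = (scheme).sub m b :=
  (congrArg c.relayDec (funext ((scheme).relayBlock_eq h m z b))).trans (not_not.1 hb)

theorem relayError_subset (m : Msgs M) :
    {z | (scheme).RelayError h m z}
      ⊆ ⋃ b, {z | (scheme).relayNoise z b ∈ c.relayFails h ((scheme).sub m b)} := by
  rintro z ⟨b, hb⟩
  exact Set.mem_iUnion.2 ⟨b, by_contra fun success =>
    hb (c.relayDec_relayBlock h hℓ fits merge_split success)⟩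

theorem decodingError_subset (m : Msgs M) :
    {z | DecodingError h (scheme).toCode m z}
      ⊆ (⋃ b, {z | (scheme).relayNoise z b ∈ c.relayFails h ((scheme).sub m b)}) ∪
        ⋃ b, ⋃ i, {z | (scheme).userNoise z i b ∈ c.userFails h ((scheme).sub m b) i} := by
  rintro z ⟨i, error⟩
  by_contra success
  simp only [Set.mem_union, Set.mem_iUnion, not_or, not_exists] at success
  refine error (funext fun p => Eq.trans ?_ (merge_split p.1 (m p.1)))
  refine congrArg (merge p.1) (funext fun b => ?_)
  have forwarded (k : Fin ℓ) : (received h (scheme).toCode m z n le_rfl).2 i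
      ⟨(b + 1 : ℕ) * ℓ + k, succ_block_index_lt fits b k⟩
      = h i * c.relayBook ((scheme).sub m b) k + (scheme).userNoise z i b k :=
    ((scheme).userBlock_eq h m z i b k).trans
      (congrArg (fun t => h i * c.relayBook t k + (scheme).userNoise z i b k)
        (c.relayDec_relayBlock h hℓ fits merge_split (success.1 b)))
  have decoded := (congrArg (fun y => c.userDec i y (sent ((scheme).sub m b) i))
    (funext forwarded)).trans (not_not.1 (success.2 b i))
  exact congrFun decoded p.1

theorem noiseLaw_relayError_le (m : Msgs M) :
    noiseLaw n {z | (scheme).RelayError h m z}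
      ≤ ∑ b, blockNoise ℓ (c.relayFails h ((scheme).sub m b)) :=
  (measure_mono (c.relayError_subset h hℓ fits merge_split m)).trans
    ((measure_iUnion_fintype_le _ _).trans
      (Finset.sum_le_sum fun b _ => (scheme).noiseLaw_relayNoise_le b _))

theorem noiseLaw_decodingError_le (m : Msgs M) :
    noiseLaw n {z | DecodingError h (scheme).toCode m z}
      ≤ ∑ b, blockNoise ℓ (c.relayFails h ((scheme).sub m b))
        + ∑ b, ∑ i, blockNoise ℓ (c.userFails h ((scheme).sub m b) i) :=
  (measure_mono (c.decodingError_subset h hℓ fits merge_split m)).trans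
    ((measure_union_le _ _).trans (add_le_add
      ((measure_iUnion_fintype_le _ _).trans
        (Finset.sum_le_sum fun b _ => (scheme).noiseLaw_relayNoise_le b _))
      ((measure_iUnion_fintype_le _ _).trans
        (Finset.sum_le_sum fun b _ => (measure_iUnion_fintype_le _ _).trans
          (Finset.sum_le_sum fun i _ => (scheme).noiseLaw_userNoise_le i b _)))))

end BlockCode

section Existence

/-- The number of values of the tuple of messages sent by the users in `S`. -/
def numFrom (K : Pair → ℕ) (S : Finset (Fin 3)) : ℕ := ∏ p : Pair with p.1.1 ∈ S, K p

theorem card_le_numFrom {K : Pair → ℕ} {w : Msgs K} {S : Finset (Fin 3)} {s : Set (Msgs K)}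
    (hs : ∀ w' ∈ s, ∀ p : Pair, p.1.1 ∉ S → w' p = w p) : s.ncard ≤ numFrom K S := by
  have subset : s ⊆ (Fintype.piFinset fun p => if p.1.1 ∈ S then Finset.univ else {w p}) := by
    intro w' hw'
    refine Finset.mem_coe.2 (Fintype.mem_piFinset.2 fun p => ?_)
    split_ifs with hp
    · exact Finset.mem_univ _
    · exact Finset.mem_singleton.2 (hs w' hw' p hp)
  refine (Set.ncard_le_ncard subset).trans_eq ?_
  simp only [Set.ncard_coe_finset, Fintype.card_piFinset, apply_ite Finset.card, Finset.card_univ,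
    Fintype.card_fin, Finset.card_singleton, Finset.prod_ite, Finset.prod_const_one, mul_one,
    numFrom]

theorem sent_eq_iff {K : Pair → ℕ} {w w' : Msgs K} {j : Fin 3} :
    sent w j = sent w' j ↔ ∀ p : Pair, p.1.1 = j → w p = w' p :=
  ⟨fun hj p hp => congrFun hj ⟨p, hp⟩, fun hp => funext fun p => hp p.1 p.2⟩

theorem sent_injective (K : Pair → ℕ) : Function.Injective (sent (M := K)) := fun _ _ h =>
  funext fun p => sent_eq_iff.1 (congrFun h p.1.1) p rfl

/-- The error bound for decoding all submessages at the relay. -/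
noncomputable def uplinkBound (h : Fin 3 → ℝ) (ε : ℝ) (q : ℝ≥0) (K : Pair → ℕ) (ℓ : ℕ) : ℝ≥0∞ :=
  randomCodingBound ε q h (numFrom K) ℓ

/-- The error bound for decoding the submessages of the other users at user `i`. -/
noncomputable def downlinkBound (h : Fin 3 → ℝ) (ε : ℝ) (q : ℝ≥0) (K : Pair → ℕ) (ℓ : ℕ)
    (i : Fin 3) : ℝ≥0∞ :=
  randomCodingBound ε q (fun _ : Unit => h i) (fun _ => numFrom K {i}ᶜ) ℓ

theorem exists_split {M K : Pair → ℕ} {B : ℕ} (hM : ∀ p, 0 < M p) (hMK : ∀ p, M p ≤ K p ^ B) :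
    ∃ (split : (p : Pair) → Fin (M p) → Fin B → Fin (K p))
      (merge : (p : Pair) → (Fin B → Fin (K p)) → Fin (M p)),
      ∀ p, Function.LeftInverse (merge p) (split p) := by
  have split (p : Pair) : Nonempty (Fin (M p) ↪ (Fin B → Fin (K p))) :=
    Function.Embedding.nonempty_of_card_le (by simpa using hMK p)
  have (p : Pair) : Nonempty (Fin (M p)) := ⟨⟨0, hM p⟩⟩
  exact ⟨fun p => (split p).some, fun p => Function.invFun (split p).some, fun p =>
    Function.leftInverse_invFun (split p).some.injective⟩

theorem prob_le_of_noiseLaw_le {M : Pair → ℕ} {n : ℕ} {E : Msgs M → Noise n → Prop}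
    {c : Msgs M → ℝ≥0∞} (hE : ∀ m, noiseLaw n {z | E m z} ≤ c m) {C : ℝ≥0∞}
    (hc : ∑ m, c m ≤ Fintype.card (Msgs M) * C) : prob E ≤ C := by
  refine ENNReal.div_le_of_le_mul ?_
  rw [mul_comm]
  exact (Finset.sum_le_sum fun m _ => hE m).trans hc

variable {h : Fin 3 → ℝ} (hh : ∀ j, h j ≠ 0) {K : Pair → ℕ} [Nonempty (Msgs K)]
  {Θ : Type*} [Fintype Θ] (w : Θ → Msgs K) {ε : ℝ} (hε : 0 ≤ ε) {q : ℝ≥0} (hq : q ≠ 0) (ℓ : ℕ)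
include hh hε hq

theorem exists_uplink_codebook :
    ∃ (x : (j : Fin 3) → Sent K j → Fin ℓ → ℝ) (D : (Fin ℓ → ℝ) → Msgs K),
      (∀ j v, ∑ k, x j v k ^ 2 ≤ ℓ * (q * (1 + ε))) ∧ Measurable D ∧
      ∑ θ, blockNoise ℓ {ζ | D (fun k => ∑ j, h j * x j (sent (w θ) j) k + ζ k) ≠ w θ}
        ≤ Fintype.card Θ * uplinkBound h ε q K ℓ := by
  obtain ⟨x, D, power, measurable_D, error⟩ := exists_codebook (R := Unit)
    (π := fun j w => sent w j) (sent_injective K) (fun _ _ => ()) (fun _ => hh)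
    (N := fun _ => numFrom K)
    (fun _ w S _ => card_le_numFrom (w := w) fun w' hw' p hp => by
      rw [← hw'.2, mem_diffSet, not_not, sent_eq_iff] at hp
      exact (hp p rfl).symm)
    w hε hq ℓ
  refine ⟨x, fun y => D () y (), power, measurable_D () (), ?_⟩
  simpa [uplinkBound, Fintype.sum_prod_type] using error

theorem exists_downlink_codebook :
    ∃ (x : Msgs K → Fin ℓ → ℝ) (D : (i : Fin 3) → (Fin ℓ → ℝ) → Sent K i → Msgs K),
      (∀ t, ∑ k, x t k ^ 2 ≤ ℓ * (q * (1 + ε))) ∧ (∀ i v, Measurable fun y => D i y v) ∧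
      ∑ θ, ∑ i, blockNoise ℓ {ζ | D i (fun k => h i * x (w θ) k + ζ k) (sent (w θ) i) ≠ w θ}
        ≤ Fintype.card Θ * ∑ i, downlinkBound h ε q K ℓ i := by
  obtain ⟨x, D, power, measurable_D, error⟩ := exists_codebook (ι := Unit)
    (π := fun _ w => w) (fun _ _ hw => congrFun hw ()) (fun i w => sent w i)
    (g := fun i _ => h i) (fun i _ => hh i) (N := fun i _ => numFrom K {i}ᶜ)
    (fun i w _ _ => card_le_numFrom (w := w) fun w' hw' p hp =>
      sent_eq_iff.1 hw'.1 p (by simpa using hp))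
    w hε hq ℓ
  refine ⟨x (), D, power (), measurable_D, ?_⟩
  simpa [downlinkBound, Fintype.sum_prod_type] using error

theorem exists_blockCode :
    ∃ c : BlockCode K ℓ, (∀ j v, ∑ k, c.userBook j v k ^ 2 ≤ ℓ * (q * (1 + ε))) ∧
      (∀ t, ∑ k, c.relayBook t k ^ 2 ≤ ℓ * (q * (1 + ε))) ∧
      ∑ θ, blockNoise ℓ (c.relayFails h (w θ)) ≤ Fintype.card Θ * uplinkBound h ε q K ℓ ∧
      ∑ θ, ∑ i, blockNoise ℓ (c.userFails h (w θ) i)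
        ≤ Fintype.card Θ * ∑ i, downlinkBound h ε q K ℓ i := by
  obtain ⟨x, D, power, measurable_D, error⟩ := exists_uplink_codebook hh w hε hq ℓ
  obtain ⟨xr, Dr, power_r, measurable_Dr, error_r⟩ := exists_downlink_codebook hh w hε hq ℓ
  exact ⟨⟨x, D, xr, Dr, measurable_D, measurable_Dr⟩, power, power_r, error, error_r⟩

theorem exists_cdfCode {M : Pair → ℕ} {n ℓ B : ℕ} (hℓ : 0 < ℓ) (fits : (B + 1) * ℓ ≤ n)
    (hM : ∀ p, 0 < M p) (hMK : ∀ p, M p ≤ K p ^ B) :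
    ∃ s : CDFCode M n, PowerConstraint h (q * (1 + ε)) s.toCode ∧
      prob (s.RelayError h) ≤ B * uplinkBound h ε q K ℓ ∧
      prob (DecodingError h s.toCode)
        ≤ B * uplinkBound h ε q K ℓ + B * ∑ i, downlinkBound h ε q K ℓ i := by
  obtain ⟨split, merge, merge_split⟩ := exists_split hM hMK
  obtain ⟨c, power, power_r, error, error_r⟩ := exists_blockCode hh
    (fun (θ : Msgs M × Fin B) p => split p (θ.1 p) θ.2) hε hq ℓ
  simp only [Fintype.card_prod, Fintype.card_fin, Fintype.sum_prod_type, Nat.cast_mul, mul_assoc]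
    at error error_r
  refine ⟨c.toCDFCode hℓ fits merge_split,
    CDFCode.powerConstraint _ h (by positivity) power power_r,
    prob_le_of_noiseLaw_le (c.noiseLaw_relayError_le h hℓ fits merge_split) error,
    prob_le_of_noiseLaw_le (c.noiseLaw_decodingError_le h hℓ fits merge_split) ?_⟩
  rw [Finset.sum_add_distrib, mul_add]
  exact add_le_add error error_r

end Existence

section Asymptotics

theorem tendsto_natCast_mul_ofReal_pow {α : Type*} {l : Filter α} {L : α → ℕ}
    (hL : Tendsto L l atTop) {N : α → ℕ} {C κ b : ℝ} (hκ : 0 ≤ κ) (hb : 0 ≤ b) (hκb : κ * b < 1)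
    (hN : ∀ i, (N i : ℝ) ≤ C * κ ^ L i) :
    Tendsto (fun i => (N i : ℝ≥0∞) * ENNReal.ofReal b ^ L i) l (𝓝 0) := by
  have geometric : Tendsto (fun i => ENNReal.ofReal (C * (κ * b) ^ L i)) l (𝓝 0) := by
    simpa using ENNReal.tendsto_ofReal (((tendsto_pow_atTop_nhds_zero_of_lt_one
      (mul_nonneg hκ hb) hκb).comp hL).const_mul C)
  refine tendsto_of_tendsto_of_tendsto_of_le_of_le tendsto_const_nhds geometric
    (fun _ => zero_le) fun i => ?_
  simp only [← ENNReal.ofReal_pow hb, ← ENNReal.ofReal_natCast,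
    ← ENNReal.ofReal_mul (Nat.cast_nonneg (N i)), mul_pow, ← mul_assoc]
  exact ENNReal.ofReal_le_ofReal (mul_le_mul_of_nonneg_right (hN i) (pow_nonneg hb _))

theorem tendsto_randomCodingBound {ι α : Type*} [Fintype ι] {l : Filter α} {L : α → ℕ}
    (hL : Tendsto L l atTop) {ε : ℝ} (hε : 0 < ε) {q : ℝ≥0} {g : ι → ℝ} {N : α → Finset ι → ℕ}
    {C κ : Finset ι → ℝ} (hκ : ∀ S, 0 ≤ κ S)
    (hN : ∀ i S, (N i S : ℝ) ≤ C S * κ S ^ L i)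
    (hlt : ∀ S : Finset ι, S.Nonempty → κ S * confusionBase ε ((∑ j ∈ S, g j ^ 2) * q) < 1) :
    Tendsto (fun i => randomCodingBound ε q g (N i) (L i)) l (𝓝 0) := by
  have deviation : Tendsto (fun i => sqDeviation ε (L i)) l (𝓝 0) :=
    (tendsto_sqDeviation hε).comp hL
  have confusion (S : Finset ι) (hS : S.Nonempty) : Tendsto (fun i => (N i S : ℝ≥0∞) *
      ENNReal.ofReal (confusionBase ε ((∑ j ∈ S, g j ^ 2) * q)) ^ L i) l (𝓝 0) :=
    tendsto_natCast_mul_ofReal_pow hL (hκ S) (by unfold confusionBase; positivity) (hlt S hS)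
      fun i => hN i S
  have bound := (ENNReal.Tendsto.const_mul (a := Fintype.card ι) deviation
    (Or.inr (ENNReal.natCast_ne_top _))).add (deviation.add
    (tendsto_finsetSum (Finset.univ.filter Finset.Nonempty) fun S hS =>
      deviation.add (confusion S (Finset.mem_filter.1 hS).2)))
  simpa [randomCodingBound, jointDecodingBound] using bound

theorem gaussC_zero : gaussC 0 = 0 := by
  rw [gaussC, add_zero, Real.logb_one, mul_zero]

theorem eventually_rpow_mul_confusionBase_lt_one {ρ τ P : ℝ} (hτ : 0 ≤ τ) (hP : 0 ≤ P)
    (hρ : ρ < gaussC (τ * P)) :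
    ∀ᶠ δ in 𝓝 0, (2 : ℝ) ^ (ρ * (1 + δ)) * confusionBase δ (τ * (P / (1 + δ))) < 1 := by
  have snr_pos : 0 < 1 + τ * P := by positivity
  have rate_continuousAt : ContinuousAt (fun δ : ℝ => (2 : ℝ) ^ (ρ * (1 + δ))) 0 :=
    ContinuousAt.rpow (by fun_prop) (by fun_prop) (Or.inl two_ne_zero)
  have snr_continuousAt : ContinuousAt (fun δ : ℝ => √(1 + τ * (P / (1 + δ)))) 0 :=
    (continuousAt_const.add (continuousAt_const.mul
      (continuousAt_const.div (by fun_prop) (by norm_num)))).sqrt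
  have base_continuousAt : ContinuousAt (fun δ : ℝ => confusionBase δ (τ * (P / (1 + δ)))) 0 :=
    Real.continuous_exp.continuousAt.mul
      (snr_continuousAt.inv₀ (by simpa using (Real.sqrt_pos.2 snr_pos).ne'))
  refine (rate_continuousAt.mul base_continuousAt).eventually_lt_const ?_
  simp only [confusionBase, Pi.mul_apply, add_zero, mul_one, div_one, Real.exp_zero, one_mul]
  rw [← div_eq_mul_inv, div_lt_one (Real.sqrt_pos.2 snr_pos), Real.lt_sqrt (by positivity),
    ← Real.rpow_mul_natCast two_pos.le, ← Real.lt_logb_iff_rpow_lt one_lt_two snr_pos]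
  rw [gaussC] at hρ
  push_cast
  linarith

/-- The sum of the rates of the messages sent by the users in `S`. -/
def rateFrom (R : Pair → ℝ≥0) (S : Finset (Fin 3)) : ℝ := ∑ p : Pair with p.1.1 ∈ S, (R p : ℝ)

theorem rateFrom_nonneg (R : Pair → ℝ≥0) (S : Finset (Fin 3)) : 0 ≤ rateFrom R S :=
  Finset.sum_nonneg fun p _ => (R p).2

theorem numMsgs_pos (R : Pair → ℝ≥0) (n : ℕ) (p : Pair) : 0 < numMsgs R n p :=
  Nat.ceil_pos.2 (by positivity)

theorem numMsgs_le (R : Pair → ℝ≥0) (n : ℕ) (p : Pair) :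
    (numMsgs R n p : ℝ) ≤ 2 * 2 ^ (n * R p : ℝ) := by
  have ceil_lt : (numMsgs R n p : ℝ) < 2 ^ (n * R p : ℝ) + 1 := Nat.ceil_lt_add_one (by positivity)
  have one_le : (1 : ℝ) ≤ 2 ^ (n * R p : ℝ) := Real.one_le_rpow one_le_two (by positivity)
  linarith

theorem numMsgs_le_pow (R : Pair → ℝ≥0) (n : ℕ) (p : Pair) {B : ℕ} (hB : 0 < B) :
    numMsgs R n p ≤ numMsgs (fun p => R p / B) n p ^ B := by
  refine Nat.ceil_le.2 ?_
  rw [Nat.cast_pow]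
  refine le_of_eq_of_le ?_ (pow_le_pow_left₀ (by positivity) (Nat.le_ceil _) B)
  rw [← Real.rpow_mul_natCast two_pos.le]
  congr 1
  push_cast
  field_simp

theorem numFrom_numMsgs_le (R : Pair → ℝ≥0) (n : ℕ) (S : Finset (Fin 3)) :
    (numFrom (numMsgs R n) S : ℝ)
      ≤ 2 ^ Finset.card {p : Pair | p.1.1 ∈ S} * 2 ^ (n * rateFrom R S) := by
  rw [numFrom, rateFrom, Nat.cast_prod, Finset.mul_sum, Real.rpow_sum_of_pos two_pos,
    ← Finset.prod_const, ← Finset.prod_mul_distrib]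
  exact Finset.prod_le_prod (fun _ _ => Nat.cast_nonneg _) fun p _ => numMsgs_le R n p

theorem numFrom_numMsgs_div_le (R : Pair → ℝ≥0) {B n ℓ : ℕ} (hB : 0 < B)
    (hn : n ≤ (B + 1) * (ℓ + 1)) (S : Finset (Fin 3)) :
    (numFrom (numMsgs (fun p => R p / B) n) S : ℝ) ≤ 2 ^ Finset.card {p : Pair | p.1.1 ∈ S}
      * 2 ^ (rateFrom R S * (1 + (B : ℝ)⁻¹)) * (2 ^ (rateFrom R S * (1 + (B : ℝ)⁻¹))) ^ ℓ := by
  have rate_div : rateFrom (fun p => R p / B) S = rateFrom R S / B := by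
    simp [rateFrom, Finset.sum_div]
  have blocks : (n : ℝ) / B ≤ (1 + (B : ℝ)⁻¹) * (ℓ + 1) := by
    have hn' : (n : ℝ) ≤ (B + 1) * (ℓ + 1) := by exact_mod_cast hn
    calc (n : ℝ) / B ≤ (B + 1) * (ℓ + 1) / B := by gcongr
      _ = (1 + (B : ℝ)⁻¹) * (ℓ + 1) := by field_simp
  refine (numFrom_numMsgs_le _ n S).trans ?_
  rw [mul_assoc, ← pow_succ', ← Real.rpow_mul_natCast two_pos.le, rate_div]
  refine mul_le_mul_of_nonneg_left (Real.rpow_le_rpow_of_exponent_le one_le_two ?_) (by positivity)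
  calc n * (rateFrom R S / B) = rateFrom R S * (n / B) := by ring
    _ ≤ rateFrom R S * ((1 + (B : ℝ)⁻¹) * (ℓ + 1)) :=
        mul_le_mul_of_nonneg_left blocks (rateFrom_nonneg R S)
    _ = rateFrom R S * (1 + (B : ℝ)⁻¹) * (ℓ + 1 : ℕ) := by push_cast; ring

theorem exists_numBlocks {h : Fin 3 → ℝ} {P : ℝ} (hP : 0 ≤ P) {R : Pair → ℝ≥0}
    (uplink : ∀ S : Finset (Fin 3), S.Nonempty → rateFrom R S < gaussC ((∑ j ∈ S, h j ^ 2) * P))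
    (downlink : ∀ i, rateFrom R {i}ᶜ < gaussC (h i ^ 2 * P)) :
    ∃ B : ℕ, 0 < B ∧
      (∀ S : Finset (Fin 3), S.Nonempty → (2 : ℝ) ^ (rateFrom R S * (1 + (B : ℝ)⁻¹)) *
        confusionBase (B : ℝ)⁻¹ ((∑ j ∈ S, h j ^ 2) * (P / (1 + (B : ℝ)⁻¹))) < 1) ∧
      ∀ i, (2 : ℝ) ^ (rateFrom R {i}ᶜ * (1 + (B : ℝ)⁻¹)) *
        confusionBase (B : ℝ)⁻¹ (h i ^ 2 * (P / (1 + (B : ℝ)⁻¹))) < 1 := by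
  have inv_tendsto : Tendsto (fun B : ℕ => (B : ℝ)⁻¹) atTop (𝓝 0) := tendsto_inv_atTop_nhds_zero_nat
  have uplink_small : ∀ᶠ B : ℕ in atTop, ∀ S : Finset (Fin 3), S.Nonempty → _ :=
    eventually_all.2 fun S => eventually_imp_distrib_left.2 fun hS => inv_tendsto.eventually
      (eventually_rpow_mul_confusionBase_lt_one (by positivity) hP (uplink S hS))
  have downlink_small := eventually_all.2 fun i => inv_tendsto.eventually
    (eventually_rpow_mul_confusionBase_lt_one (sq_nonneg (h i)) hP (downlink i))
  exact ((eventually_gt_atTop 0).and (uplink_small.and downlink_small)).exists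

section BlockErrors

variable {h : Fin 3 → ℝ} {R : Pair → ℝ≥0} {B : ℕ} (hB : 0 < B) {q : ℝ≥0}
  {α : Type*} {l : Filter α} {n L : α → ℕ} (hL : Tendsto L l atTop)
  (hn : ∀ i, n i ≤ (B + 1) * (L i + 1))
include hB hL hn

theorem tendsto_uplinkBound (small : ∀ S : Finset (Fin 3), S.Nonempty →
    (2 : ℝ) ^ (rateFrom R S * (1 + (B : ℝ)⁻¹)) *
      confusionBase (B : ℝ)⁻¹ ((∑ j ∈ S, h j ^ 2) * q) < 1) :
    Tendsto (fun i => uplinkBound h (B : ℝ)⁻¹ q (numMsgs (fun p => R p / B) (n i)) (L i))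
      l (𝓝 0) :=
  tendsto_randomCodingBound hL (by positivity) (fun S => by positivity)
    (fun i S => numFrom_numMsgs_div_le R hB (hn i) S) small

theorem tendsto_downlinkBound {j : Fin 3} (small : (2 : ℝ) ^ (rateFrom R {j}ᶜ * (1 + (B : ℝ)⁻¹)) *
      confusionBase (B : ℝ)⁻¹ (h j ^ 2 * q) < 1) :
    Tendsto (fun i => downlinkBound h (B : ℝ)⁻¹ q (numMsgs (fun p => R p / B) (n i)) (L i) j)
      l (𝓝 0) :=
  tendsto_randomCodingBound hL (by positivity) (κ := fun _ => _) (fun _ => by positivity)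
    (fun i _ => numFrom_numMsgs_div_le R hB (hn i) {j}ᶜ) fun S hS => by
      rwa [hS.eq_univ, Fintype.sum_unique]

end BlockErrors

theorem cdfAchievable_of_lt {h : Fin 3 → ℝ} {P : ℝ} (hP : 0 ≤ P) {R : Pair → ℝ≥0}
    (uplink : ∀ S : Finset (Fin 3), S.Nonempty → rateFrom R S < gaussC ((∑ j ∈ S, h j ^ 2) * P))
    (downlink : ∀ i, rateFrom R {i}ᶜ < gaussC (h i ^ 2 * P)) : CDFAchievable h P R := by
  have snr_ne_zero (i : Fin 3) : h i ^ 2 * P ≠ 0 := fun snr => by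
    have rate_neg := downlink i
    rw [snr, gaussC_zero] at rate_neg
    exact rate_neg.not_ge (rateFrom_nonneg R _)
  have hh (i : Fin 3) : h i ≠ 0 := fun hi => snr_ne_zero i (by simp [hi])
  lift P to ℝ≥0 using hP
  obtain ⟨B, hB, uplink_small, downlink_small⟩ := exists_numBlocks P.2 uplink downlink
  obtain ⟨q, hq⟩ : ∃ q : ℝ≥0, (q : ℝ) = P / (1 + (B : ℝ)⁻¹) := ⟨P / (1 + (B : ℝ≥0)⁻¹), by simp⟩
  have power_eq : q * (1 + (B : ℝ)⁻¹) = P := by rw [hq]; field_simp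
  have hq_ne : q ≠ 0 := by
    rintro rfl
    exact snr_ne_zero 0 (by simp [← power_eq])
  let L (i : ℕ) : ℕ := (B + 1 + i) / (B + 1)
  have hL : Tendsto L atTop atTop := (Nat.tendsto_div_const_atTop B.succ_ne_zero).comp
    (tendsto_atTop_mono (fun i => Nat.le_add_left i (B + 1)) tendsto_id)
  have length_le (i : ℕ) : B + 1 + i ≤ (B + 1) * (L i + 1) :=
    (Nat.lt_mul_div_succ _ B.succ_pos).le
  have (i : ℕ) : Nonempty (Msgs (numMsgs (fun p => R p / B) (B + 1 + i))) :=
    ⟨fun p => ⟨0, numMsgs_pos _ _ p⟩⟩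
  have ε_nonneg : 0 ≤ (B : ℝ)⁻¹ := by positivity
  choose s power relay_error error using fun i => exists_cdfCode hh ε_nonneg hq_ne
    (Nat.div_pos (Nat.le_add_right _ i) B.succ_pos) (Nat.mul_div_le (B + 1 + i) (B + 1))
    (numMsgs_pos R (B + 1 + i)) fun p => numMsgs_le_pow R (B + 1 + i) p hB
  have relay_bound := ENNReal.Tendsto.const_mul
    (tendsto_uplinkBound hB hL length_le (by rwa [hq])) (Or.inr (ENNReal.natCast_ne_top B))
  have user_bound := relay_bound.add (ENNReal.Tendsto.const_mul (tendsto_finsetSum Finset.univ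
    fun j _ => tendsto_downlinkBound hB hL length_le (hq ▸ downlink_small j))
    (Or.inr (ENNReal.natCast_ne_top B)))
  simp only [Finset.sum_const_zero, mul_zero, add_zero] at relay_bound user_bound
  exact ⟨B + 1, s, power_eq ▸ power, tendsto_of_tendsto_of_tendsto_of_le_of_le tendsto_const_nhds
    user_bound (fun _ => zero_le) error, tendsto_of_tendsto_of_tendsto_of_le_of_le
    tendsto_const_nhds relay_bound (fun _ => zero_le) relay_error⟩

end Asymptotics

section SumRates

theorem gaussC_le_gaussC {x y : ℝ} (hx : 0 ≤ x) (hxy : x ≤ y) : gaussC x ≤ gaussC y := by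
  have snr_pos : 0 < 1 + x := by linarith
  exact mul_le_mul_of_nonneg_left
    (Real.logb_le_logb_of_le one_lt_two snr_pos (by linarith)) (by norm_num)

theorem sum_coe_eq_ofReal_rateFrom (R : Pair → ℝ≥0) :
    ∑ p, (R p : ℝ≥0∞) = ENNReal.ofReal (rateFrom R Finset.univ) := by
  simp [rateFrom, ENNReal.ofReal_sum_of_nonneg]

theorem rateFrom_const_mul (t : ℝ≥0) (R : Pair → ℝ≥0) (S : Finset (Fin 3)) :
    rateFrom (fun p => t * R p) S = t * rateFrom R S := by
  simp [rateFrom, Finset.mul_sum]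

theorem rateFrom_add_rateFrom_compl (R : Pair → ℝ≥0) (S : Finset (Fin 3)) :
    rateFrom R S + rateFrom R Sᶜ = rateFrom R Finset.univ := by
  simpa [rateFrom] using Finset.sum_filter_add_sum_filter_not Finset.univ
    (fun p : Pair => p.1.1 ∈ S) fun p => (R p : ℝ)

theorem rateFrom_sender_div_two (r : Fin 3 → ℝ≥0) (S : Finset (Fin 3)) :
    rateFrom (fun p => r p.1.1 / 2) S = ∑ j ∈ S, (r j : ℝ) := by
  have two_messages : ∀ S : Finset (Fin 3), ∀ j ∈ S,
      Finset.card {p ∈ Finset.univ.filter fun p : Pair => p.1.1 ∈ S | p.1.1 = j} = 2 := by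
    decide
  rw [rateFrom, Finset.sum_comp (fun j => ((r j / 2 : ℝ≥0) : ℝ)) fun p : Pair => p.1.1]
  have senders : (Finset.univ.filter fun p : Pair => p.1.1 ∈ S).image (fun p => p.1.1) = S := by
    revert S; decide
  rw [senders]
  refine Finset.sum_congr rfl fun j hj => ?_
  rw [two_messages S j hj]
  simp [mul_div_cancel₀]

variable {h : Fin 3 → ℝ} {P : ℝ}

theorem cdfAchievable_const_mul (hP : 0 ≤ P) {R : Pair → ℝ≥0}
    (capacity_pos : ∀ i, 0 < gaussC (h i ^ 2 * P))
    (uplink : ∀ S : Finset (Fin 3), S.Nonempty → rateFrom R S ≤ gaussC ((∑ j ∈ S, h j ^ 2) * P))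
    (downlink : ∀ i, rateFrom R {i}ᶜ ≤ gaussC (h i ^ 2 * P)) {t : ℝ≥0} (ht : t < 1) :
    CDFAchievable h P fun p => t * R p := by
  have scaled_lt {a b : ℝ} (hab : a ≤ b) (hb : 0 < b) : t * a < b :=
    (mul_le_mul_of_nonneg_left hab t.2).trans_lt (mul_lt_of_lt_one_left hb ht)
  have uplink_pos (S : Finset (Fin 3)) (hS : S.Nonempty) :
      0 < gaussC ((∑ j ∈ S, h j ^ 2) * P) := by
    obtain ⟨i, hi⟩ := hS
    refine (capacity_pos i).trans_le (gaussC_le_gaussC (by positivity) ?_)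
    exact mul_le_mul_of_nonneg_right
      (Finset.single_le_sum (f := fun j => h j ^ 2) (fun j _ => sq_nonneg (h j)) hi) hP
  refine cdfAchievable_of_lt hP (fun S hS => ?_) fun i => ?_ <;> rw [rateFrom_const_mul]
  · exact scaled_lt (uplink S hS) (uplink_pos S hS)
  · exact scaled_lt (downlink i) (capacity_pos i)

theorem sum_le_cdfSumRate (hP : 0 ≤ P) {R : Pair → ℝ≥0}
    (uplink : ∀ S : Finset (Fin 3), S.Nonempty → rateFrom R S ≤ gaussC ((∑ j ∈ S, h j ^ 2) * P))
    (downlink : ∀ i, rateFrom R {i}ᶜ ≤ gaussC (h i ^ 2 * P)) :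
    ∑ p, (R p : ℝ≥0∞) ≤ cdfSumRate h P := by
  by_cases capacity_pos : ∀ i, 0 < gaussC (h i ^ 2 * P)
  · refine ENNReal.le_of_forall_lt_one_mul_le fun t ht => ?_
    lift t to ℝ≥0 using ne_top_of_lt ht
    refine le_iSup₂_of_le _ (cdfAchievable_const_mul hP capacity_pos uplink downlink
      (ENNReal.coe_lt_one_iff.1 ht)) ?_
    simp [Finset.mul_sum]
  · obtain ⟨i, hi⟩ := not_forall.1 capacity_pos
    have uplink_i := uplink {i} (Finset.singleton_nonempty i)
    rw [Finset.sum_singleton] at uplink_i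
    have sum_nonpos : rateFrom R Finset.univ ≤ 0 := by
      rw [← rateFrom_add_rateFrom_compl R {i}]
      linarith [downlink i]
    rw [sum_coe_eq_ofReal_rateFrom, ENNReal.ofReal_of_nonpos sum_nonpos]
    exact zero_le

theorem ofReal_sum_le_cdfSumRate (hP : 0 ≤ P) {r : Fin 3 → ℝ≥0}
    (single : ∀ i, r i ≤ gaussC (h i ^ 2 * P))
    (pair : ∀ i, ∑ j ∈ {i}ᶜ, (r j : ℝ) ≤ gaussC (min (h i ^ 2) (∑ j ∈ {i}ᶜ, h j ^ 2) * P))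
    (total : ∑ i, (r i : ℝ) ≤ gaussC ((∑ i, h i ^ 2) * P)) :
    ENNReal.ofReal (∑ i, (r i : ℝ)) ≤ cdfSumRate h P := by
  have gaussC_mono {x y : ℝ} (hx : 0 ≤ x) (hxy : x ≤ y) : gaussC (x * P) ≤ gaussC (y * P) :=
    gaussC_le_gaussC (by positivity) (mul_le_mul_of_nonneg_right hxy hP)
  have subsets : ∀ S : Finset (Fin 3), S.Nonempty →
      (∃ i, S = {i}) ∨ (∃ i, S = {i}ᶜ) ∨ S = Finset.univ := by decide
  rw [← rateFrom_sender_div_two, ← sum_coe_eq_ofReal_rateFrom]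
  refine sum_le_cdfSumRate hP (fun S hS => ?_) fun i => ?_ <;> rw [rateFrom_sender_div_two]
  · obtain ⟨i, rfl⟩ | ⟨i, rfl⟩ | rfl := subsets S hS
    · simpa using single i
    · exact (pair i).trans (gaussC_mono (by positivity) (min_le_right _ _))
    · exact total
  · exact (pair i).trans (gaussC_mono (by positivity) (min_le_left _ _))

theorem sum_compl_singleton (f : Fin 3 → ℝ) (i : Fin 3) :
    ∑ j ∈ {i}ᶜ, f j = ![f 1 + f 2, f 0 + f 2, f 0 + f 1] i := by
  have sum_univ : f i + ∑ j ∈ {i}ᶜ, f j = f 0 + f 1 + f 2 := by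
    rw [← Fin.sum_univ_three, ← Finset.sum_add_sum_compl {i}, Finset.sum_singleton]
  rw [← eq_sub_iff_add_eq'] at sum_univ
  rw [sum_univ]
  fin_cases i <;> simp <;> ring

theorem exists_rates {A : Fin 3 → ℝ} (hA : Antitone A) {T : ℝ} (hT : 0 ≤ T)
    (half_sum : T ≤ 1 / 2 * ∑ i, A i) (twice_last : T ≤ 2 * A 2) :
    ∃ r : Fin 3 → ℝ≥0, ∑ i, (r i : ℝ) = T ∧ (∀ i, ∑ j ∈ {i}ᶜ, (r j : ℝ) ≤ A i) ∧
      ∀ i, r i ≤ A 2 := by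
  have A₁_le : A 1 ≤ A 0 := hA (by decide)
  have A₂_le : A 2 ≤ A 1 := hA (by decide)
  rw [Fin.sum_univ_three] at half_sum
  obtain ⟨r₀, r₁, r₂, r₀_nonneg, r₁_nonneg, r₂_nonneg, sum_eq, le₀, le₁, le₂, r₂_le⟩ :
      ∃ r₀ r₁ r₂ : ℝ, 0 ≤ r₀ ∧ 0 ≤ r₁ ∧ 0 ≤ r₂ ∧ r₀ + r₁ + r₂ = T ∧
        r₁ + r₂ ≤ A 0 ∧ r₀ + r₂ ≤ A 1 ∧ r₀ + r₁ ≤ A 2 ∧ r₂ ≤ A 2 := by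
    -- User `i < 2` has to carry at least `max 0 (T - A i)`; user `2` takes what it can of the rest.
    let m₀ := max 0 (T - A 0)
    let m₁ := max 0 (T - A 1)
    let m₂ := min (A 2) (T - m₀ - m₁)
    refine ⟨m₀, T - m₀ - m₂, m₂, ?_⟩
    grind
  lift r₀ to ℝ≥0 using r₀_nonneg
  lift r₁ to ℝ≥0 using r₁_nonneg
  lift r₂ to ℝ≥0 using r₂_nonneg
  refine ⟨![r₀, r₁, r₂], by simpa [Fin.sum_univ_three] using sum_eq, ?_, ?_⟩
  · simpa [sum_compl_singleton, Fin.forall_fin_succ] using ⟨le₀, le₁, le₂⟩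
  · simpa [Fin.forall_fin_succ] using
      ⟨by linarith [r₁.2], by linarith [r₀.2], r₂_le⟩

end SumRates

section LowerBound

/-- The code in which nobody sends and every user always guesses the first messages. -/
noncomputable def silentCode {M : Pair → ℕ} (hM : ∀ p, 0 < M p) (n : ℕ) : Code M n where
  userEnc _ _ _ _ := 0
  relayEnc _ _ := 0
  dec _ _ _ p := ⟨0, hM p.1⟩
  measurable_userEnc _ _ _ := measurable_const
  measurable_relayEnc _ := measurable_const
  measurable_dec _ _ := measurable_const

theorem powerConstraint_silentCode {M : Pair → ℕ} (hM : ∀ p, 0 < M p) (n : ℕ) (h : Fin 3 → ℝ)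
    (P : ℝ) : PowerConstraint h P (silentCode hM n) := by
  simp [PowerConstraint, userInput, relayInput, silentCode, expect]

theorem CDFAchievable.achievable {h : Fin 3 → ℝ} {P : ℝ} {R : Pair → ℝ≥0}
    (hR : CDFAchievable h P R) : Achievable h P R := by
  obtain ⟨N, s, power, error, -⟩ := hR
  have exists_code (n : ℕ) : ∃ c : Code (numMsgs R n) n, PowerConstraint h P c ∧
      ∀ i, n = i + N → prob (DecodingError h c) = prob (DecodingError h (s i).toCode) := by
    rcases le_or_gt N n with hn | hn
    · obtain ⟨i, rfl⟩ := Nat.exists_eq_add_of_le hn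
      refine ⟨(s i).toCode, power i, fun i' hi' => ?_⟩
      obtain rfl : i = i' := by omega
      rfl
    · exact ⟨silentCode (numMsgs_pos R n) n, powerConstraint_silentCode _ _ _ _,
        fun i hi => by omega⟩
  choose c power_c error_c using exists_code
  refine ⟨c, power_c, (tendsto_add_atTop_iff_nat N).1 (error.congr fun i => ?_)⟩
  exact (error_c (i + N) i rfl).symm

theorem cdfSumRate_le_sumCapacity (h : Fin 3 → ℝ) (P : ℝ) : cdfSumRate h P ≤ sumCapacity h P :=
  iSup₂_le fun R hR => le_iSup₂_of_le R hR.achievable le_rfl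

theorem ofReal_cdfBound_le_cdfSumRate {h₁ h₂ h₃ : ℝ} (h₂₁ : h₂ ^ 2 ≤ h₁ ^ 2)
    (h₃₂ : h₃ ^ 2 ≤ h₂ ^ 2) {P : ℝ} (hP : 0 ≤ P) :
    ENNReal.ofReal (cdfBound h₁ h₂ h₃ P) ≤ cdfSumRate ![h₁, h₂, h₃] P := by
  rcases le_or_gt (cdfBound h₁ h₂ h₃ P) 0 with nonpos | pos
  · exact (ENNReal.ofReal_of_nonpos nonpos).trans_le zero_le
  let h : Fin 3 → ℝ := ![h₁, h₂, h₃]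
  let g : Fin 3 → ℝ := ![min (h₁ ^ 2) (h₂ ^ 2 + h₃ ^ 2), h₂ ^ 2, h₃ ^ 2]
  have g_antitone : Antitone g := by
    rw [Fin.antitone_iff_succ_le]
    simpa [Fin.forall_fin_succ, g] using ⟨⟨h₂₁, sq_nonneg h₃⟩, h₃₂⟩
  have g_eq (i : Fin 3) : g i = min (h i ^ 2) (∑ j ∈ {i}ᶜ, h j ^ 2) := by
    rw [sum_compl_singleton]
    fin_cases i <;> simp [g, h] <;> nlinarith [sq_nonneg h₁, sq_nonneg h₃]
  have g_nonneg (i : Fin 3) : 0 ≤ g i := by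
    rw [g_eq]
    positivity
  have capacity_mono {x y : ℝ} (hx : 0 ≤ x) (hxy : x ≤ y) : gaussC (x * P) ≤ gaussC (y * P) :=
    gaussC_le_gaussC (by positivity) (mul_le_mul_of_nonneg_right hxy hP)
  have half_sum : cdfBound h₁ h₂ h₃ P ≤ _ := min_le_left _ _
  have total : cdfBound h₁ h₂ h₃ P ≤ _ := (min_le_right _ _).trans (min_le_left _ _)
  have twice_last : cdfBound h₁ h₂ h₃ P ≤ _ := (min_le_right _ _).trans (min_le_right _ _)
  obtain ⟨r, sum_eq, pair, single⟩ := exists_rates (A := fun i => gaussC (g i * P))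
    (fun i j hij => capacity_mono (g_nonneg j) (g_antitone hij)) pos.le
    (by rw [Fin.sum_univ_three]; exact half_sum) twice_last
  rw [← sum_eq]
  refine ofReal_sum_le_cdfSumRate hP (fun i => (single i).trans ?_) (fun i => g_eq i ▸ pair i) ?_
  · exact capacity_mono (g_nonneg 2) ((g_antitone (Fin.le_last i)).trans
      ((g_eq i).trans_le (min_le_left _ _)))
  · rw [sum_eq, Fin.sum_univ_three]
    exact total

end LowerBound

section DegreesOfFreedom

theorem tendsto_gaussC_div_log {a : ℝ} (ha : 0 < a) :
    Tendsto (fun P : ℝ => gaussC (a * P) / (1 / 2 * Real.logb 2 P)) atTop (𝓝 1) := by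
  have log_tendsto : Tendsto (fun P : ℝ => Real.log (P⁻¹ + a)) atTop (𝓝 (Real.log (0 + a))) :=
    (tendsto_inv_atTop_zero.add tendsto_const_nhds).log (by linarith)
  have ratio_tendsto : Tendsto (fun P : ℝ => 1 + Real.log (P⁻¹ + a) / Real.log P) atTop (𝓝 1) := by
    simpa using (log_tendsto.div_atTop Real.tendsto_log_atTop).const_add 1
  refine ratio_tendsto.congr' ?_
  filter_upwards [eventually_gt_atTop 1] with P hP
  have log_ne_zero : Real.log P ≠ 0 := (Real.log_pos hP).ne'
  have P_pos : 0 < P := by linarith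
  have log_snr : Real.log (1 + a * P) = Real.log P + Real.log (P⁻¹ + a) := by
    rw [← Real.log_mul P_pos.ne' (by positivity)]
    congr 1
    field_simp
  have log_two_ne_zero : Real.log 2 ≠ 0 := (Real.log_pos one_lt_two).ne'
  rw [gaussC, Real.logb, Real.logb, log_snr]
  field_simp

theorem tendsto_cdfBound_div_log {h₁ h₂ h₃ : ℝ} (hh₁ : h₁ ≠ 0) (hh₂ : h₂ ≠ 0) (hh₃ : h₃ ≠ 0) :
    Tendsto (fun P : ℝ => cdfBound h₁ h₂ h₃ P / (1 / 2 * Real.logb 2 P)) atTop (𝓝 1) := by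
  have half_sum := (((tendsto_gaussC_div_log (a := min (h₁ ^ 2) (h₂ ^ 2 + h₃ ^ 2))
    (by positivity)).add (tendsto_gaussC_div_log (a := h₂ ^ 2) (by positivity))).add
    (tendsto_gaussC_div_log (a := h₃ ^ 2) (by positivity))).const_mul (1 / 2)
  have total := tendsto_gaussC_div_log (a := h₁ ^ 2 + h₂ ^ 2 + h₃ ^ 2) (by positivity)
  have twice_last := (tendsto_gaussC_div_log (a := h₃ ^ 2) (by positivity)).const_mul 2
  have min_tendsto := half_sum.min (total.min twice_last)
  rw [show min (1 / 2 * ((1 : ℝ) + 1 + 1)) (min 1 (2 * 1)) = 1 by norm_num] at min_tendsto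
  refine min_tendsto.congr' ?_
  filter_upwards [eventually_gt_atTop 1] with P hP
  have log_nonneg : 0 ≤ 1 / 2 * Real.logb 2 P :=
    mul_nonneg (by norm_num) (Real.logb_nonneg one_lt_two hP.le)
  rw [cdfBound, ← min_div_div_right log_nonneg, ← min_div_div_right log_nonneg, ← add_div,
    ← add_div, mul_div_assoc, mul_div_assoc]

end DegreesOfFreedom

end YChannel

theorem mainTheorem8 (h₁ h₂ h₃ : ℝ) (h₂₁ : h₂ ^ 2 ≤ h₁ ^ 2) (h₃₂ : h₃ ^ 2 ≤ h₂ ^ 2) :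
    (∀ P : ℝ, 0 ≤ P →
      ENNReal.ofReal (YChannel.cdfBound h₁ h₂ h₃ P) ≤ YChannel.sumCapacity ![h₁, h₂, h₃] P ∧
      ENNReal.ofReal (YChannel.cdfBound h₁ h₂ h₃ P) ≤ YChannel.cdfSumRate ![h₁, h₂, h₃] P) ∧
    (h₃ ≠ 0 →
      Tendsto (fun P : ℝ => YChannel.cdfBound h₁ h₂ h₃ P / (1 / 2 * Real.logb 2 P))
        atTop (𝓝 1)) := by
  refine ⟨fun P hP => ?_, fun hh₃ => ?_⟩
  · have cdf := YChannel.ofReal_cdfBound_le_cdfSumRate h₂₁ h₃₂ hP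
    exact ⟨cdf.trans (YChannel.cdfSumRate_le_sumCapacity _ _), cdf⟩
  · have sq_pos₂ : 0 < h₂ ^ 2 := (by positivity : 0 < h₃ ^ 2).trans_le h₃₂
    exact YChannel.tendsto_cdfBound_div_log (pow_ne_zero_iff two_ne_zero |>.1
      (sq_pos₂.trans_le h₂₁).ne') (pow_ne_zero_iff two_ne_zero |>.1 sq_pos₂.ne') hh₃
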